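/- **Setting.** Let $E$ be a $d$-dimensional real Euclidean vector space with a fixed orientation, and let $\Omega_E\in\bigwedge^d E^*$ be its volume form, equal to $1$ on positively oriented orthonormal bases. A $d$-dimensional *FBS-complex* is a finite connected semi-simplicial set ($\Delta$-complex) $B$ of dimension $d$ with a homomorphism $\rho:C_1(B,\mathbb Z)\to E$ such that $\rho\circ\partial=0$ and such that, for every $k$-simplex $s$ with edges $e_1,\dots,e_k$ originating in the same vertex of $s$, the vectors $\rho(e_1),\dots,\rho(e_k)$ are linearly independent. Write $|s|\subset|B|$ for the open simplex of $s$ in the geometric realization. For a $d$-simplex $s$ let $\alpha_s$ be the homeomorphism, in barycentric coordinates, from $|s|$ onto the interior of the affine simplex with vertices $0,\rho(e_1),\dots,\rho(e_d)$, where $e_i$ is the edge from vertex $0$ to vertex $i$ of $s$. The closed simplex $\overline{\alpha_s(|s|)}$ is the *prototile* of $s$. The orientation of $E$ orients every $d$-simplex of $B$ through $\alpha_s$. The *closed positive cone* $Z_d^+(B,\mathbb R)$ is the set of cycles in $Z_d(B,\mathbb R)$ whose coefficients in the basis of positively oriented $d$-simplices are all non-negative. An *isometric winding* of $B$ is a continuous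 map $f:E\to|B|$ such that, for every $d$-simplex $s$, the set $f^{-1}(|s|)$ is a disjoint union of interiors of translated copies $\sigma_{s,i}=\overline{\alpha_s(|s|)}-\tau_{s,i}$ of the prototile of $s$, with $\alpha_s(f(x))=x+\tau_{s,i}$ on the interior of $\sigma_{s,i}$, and such that the tiles $\sigma_{s,i}$ cover $E$. Let $\Lambda$ be a lattice in a finite-dimensional real vector space $V$ (so $V=\Lambda\otimes\mathbb R$). Let $\lambda:H_1(B,\mathbb Z)\to\Lambda$ be a surjective homomorphism and $\pi_E:V\to E$ a linear map such that $\pi_E\circ\lambda=\rho_*$, where $\rho_*:H_1(B,\mathbb Z)\to E$ is induced by $\rho$. Let $\tilde\rho:C_1(B,\mathbb Z)\to V$ be a homomorphism with $\pi_E\circ\tilde\rho=\rho$ whose restriction to cycles is $\lambda$ of their homology classes, let $v_0$ be a vertex of $B$, and let $y_0\in V$. Let $\beta:|B|\to V/\Lambda$ be the continuous map that sends a vertex $v$ to $y_0+\tilde\rho(\gamma)\bmod\Lambda$, where $\gamma$ is any $1$-chain with $\partial\gamma=v-v_0$, and that on each closed simplex is the reduction modulo $\Lambda$ of the map, affine in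 barycentric coordinates, under which each edge $e$ has displacement $\tilde\rho(e)$. Let $\omega_E\in H^d(V/\Lambda,\mathbb R)$ be the de Rham class of the constant form $\pi_E^\top\Omega_E$ on the torus $V/\Lambda$, regarded as a linear functional on $H_d(V/\Lambda,\mathbb R)$. **Proposition.** Let $f$ be an isometric winding of $B$. For $r\in\mathbb N^*$ let $\mathcal B_r=\{x\in E:\|x\|<r\}$, let $\mathcal P_r$ be the sum of all positively oriented tiles $\sigma_{s,i}$ contained in $\mathcal B_r$, and put $$c_r=\frac{f_*(\mathcal P_r)}{\mathrm{vol}(\mathcal B_r)}\in C_d(B,\mathbb R),$$ so that the coefficient of $c_r$ at a positively oriented $d$-simplex is the number of its tiles contained in $\mathcal B_r$, divided by $\mathrm{vol}(\mathcal B_r)$. Then there is a class $c\in H_d(B,\mathbb R)$ with $$\omega_E(\beta_*(c))=1$$ that is represented by a cycle in $Z_d^+(B,\mathbb R)$ which is an accumulation point of the sequence $(c_r)_{r\in\mathbb N^*}$ in the finite-dimensional space $C_d(B,\mathbb R)$. -/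

import Mathlib

namespace FBS

open MeasureTheory Set
open scoped ContDiff

/-- The standard solid simplex `{x | 0 ≤ x i, ∑ x i ≤ 1}` in `ℝ ^ k`. -/
def solidSimplex (k : ℕ) : Set (Fin k → ℝ) := {x | (∀ i, 0 ≤ x i) ∧ ∑ i, x i ≤ 1}

/-- Barycentric coordinates `(1 - ∑ x i, x 1, …, x k)` of a point of the solid simplex. -/
def bary {k : ℕ} (x : Fin k → ℝ) : Fin (k + 1) → ℝ := Fin.cons (1 - ∑ i, x i) x

theorem isClosed_solidSimplex (k : ℕ) : IsClosed (solidSimplex k) := by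
  have : solidSimplex k = (⋂ i, {x : Fin k → ℝ | 0 ≤ x i}) ∩ {x | ∑ i, x i ≤ 1} := by
    ext x; simp [solidSimplex]
  rw [this]
  refine (isClosed_iInter fun i => ?_).inter ?_
  · exact isClosed_le continuous_const (continuous_apply i)
  · exact isClosed_le (by fun_prop) continuous_const

theorem isCompact_solidSimplex (k : ℕ) : IsCompact (solidSimplex k) := by
  refine (isCompact_Icc (a := (0 : Fin k → ℝ)) (b := 1)).of_isClosed_subset
    (isClosed_solidSimplex k) fun x hx => ⟨hx.1, fun i => ?_⟩
  exact (Finset.single_le_sum (fun j _ => hx.1 j) (Finset.mem_univ i)).trans hx.2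

theorem convex_solidSimplex (k : ℕ) : Convex ℝ (solidSimplex k) := by
  intro x hx y hy a b ha hb hab
  refine ⟨fun i => ?_, ?_⟩
  · have := hx.1 i; have := hy.1 i
    simp only [Pi.add_apply, Pi.smul_apply, smul_eq_mul]; positivity
  · simp only [Pi.add_apply, Pi.smul_apply, smul_eq_mul, Finset.sum_add_distrib, ← Finset.mul_sum]
    nlinarith [hx.2, hy.2]

theorem insertNth_mem_solidSimplex {k : ℕ} (j : Fin (k + 1)) (t : ℝ) (y : Fin k → ℝ) :
    (j.insertNth t y : Fin (k + 1) → ℝ) ∈ solidSimplex (k + 1) ↔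
      y ∈ solidSimplex k ∧ t ∈ Icc 0 (1 - ∑ i, y i) := by
  simp only [solidSimplex, mem_ofPred_eq, Fin.forall_iff_succAbove j, Fin.insertNth_apply_same,
    Fin.insertNth_apply_succAbove, Fin.sum_univ_succAbove _ j, mem_Icc]
  constructor
  · rintro ⟨⟨h1, h2⟩, h3⟩
    exact ⟨⟨h2, by linarith⟩, h1, by linarith⟩
  · rintro ⟨⟨h1, h2⟩, h3, h4⟩
    exact ⟨⟨h3, h1⟩, by linarith⟩

theorem setIntegral_solidSimplex_succ {k : ℕ} (j : Fin (k + 1)) (F : (Fin (k + 1) → ℝ) → ℝ)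
    (hF : Continuous F) :
    ∫ x in solidSimplex (k + 1), F x =
      ∫ y in solidSimplex k, ∫ t in (0 : ℝ)..(1 - ∑ i, y i), F (j.insertNth t y) := by
  classical
  have hm := (volume_preserving_piFinSuccAbove (fun _ : Fin (k + 1) => ℝ) j).symm
  rw [← integral_indicator (isClosed_solidSimplex _).measurableSet,
    ← hm.integral_comp (MeasurableEquiv.measurableEmbedding _)]
  have hint : Integrable (fun p : ℝ × (Fin k → ℝ) => (solidSimplex (k + 1)).indicator F
      ((MeasurableEquiv.piFinSuccAbove (fun _ : Fin (k + 1) => ℝ) j).symm p))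
      (volume.prod volume) := by
    have h0 : Integrable ((solidSimplex (k + 1)).indicator F) volume :=
      (integrable_indicator_iff (isClosed_solidSimplex _).measurableSet).2
        (hF.continuousOn.integrableOn_compact (isCompact_solidSimplex _))
    exact (hm.integrable_comp_emb (MeasurableEquiv.measurableEmbedding _)).2 h0
  have e : (volume : Measure (ℝ × (Fin k → ℝ))) = volume.prod volume := rfl
  rw [e, integral_prod_symm _ hint, ← integral_indicator (isClosed_solidSimplex _).measurableSet]
  refine integral_congr_ae (Filter.Eventually.of_forall fun y => ?_)
  have key : ∀ t : ℝ, (solidSimplex (k + 1)).indicator F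
      ((MeasurableEquiv.piFinSuccAbove (fun _ : Fin (k + 1) => ℝ) j).symm (t, y)) =
      if y ∈ solidSimplex k ∧ t ∈ Icc 0 (1 - ∑ i, y i) then F (j.insertNth t y) else 0 := by
    intro t
    have : (MeasurableEquiv.piFinSuccAbove (fun _ : Fin (k + 1) => ℝ) j).symm (t, y) =
      j.insertNth t y := rfl
    rw [this]
    classical
    rw [indicator_apply]
    simp only [insertNth_mem_solidSimplex]
  simp only [key]
  by_cases hy : y ∈ solidSimplex k
  · rw [indicator_of_mem hy, intervalIntegral.integral_of_le (by linarith [hy.2]),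
      ← integral_Icc_eq_integral_Ioc, ← integral_indicator measurableSet_Icc]
    refine integral_congr_ae (Filter.Eventually.of_forall fun t => ?_)
    classical
    simp [indicator_apply, hy]
  · simp [hy]

theorem measurePreserving_swap {k : ℕ} (m : Fin k) :
    MeasurePreserving (fun y : Fin k → ℝ => Function.update y m (1 - ∑ i, y i)) := by
  let L : (Fin k → ℝ) →ₗ[ℝ] (Fin k → ℝ) :=
    { toFun := fun y => Function.update y m (- ∑ i, y i)
      map_add' := fun x y => by
        ext i
        rcases eq_or_ne i m with rfl | h
        · simp [Finset.sum_add_distrib]; ring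
        · simp [h]
      map_smul' := fun c x => by
        ext i
        rcases eq_or_ne i m with rfl | h
        · simp [Finset.mul_sum]
        · simp [h] }
  have hLL : L ∘ₗ L = LinearMap.id := by
    ext1 i
    ext1
    ext j
    simp only [LinearMap.comp_apply, LinearMap.id_apply, L, LinearMap.coe_mk, AddHom.coe_mk,
      Function.update_idem]
    rcases eq_or_ne j m with rfl | h
    · rw [Function.update_self, Finset.sum_update_of_mem (Finset.mem_univ _),
        Finset.sdiff_singleton_eq_erase]
      have := Finset.sum_erase_add Finset.univ
        ((LinearMap.single ℝ (fun _ : Fin k => ℝ) i) 1) (Finset.mem_univ j)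
      linarith
    · simp [h]
  have hdet : LinearMap.det L * LinearMap.det L = 1 := by
    rw [← LinearMap.det_comp, hLL, LinearMap.det_id]
  have hne : LinearMap.det L ≠ 0 := fun h => by simp [h] at hdet
  have habs : |(LinearMap.det L)⁻¹| = 1 := by
    rcases mul_self_eq_one_iff.1 hdet with h | h <;> simp [h]
  have h1 : MeasurePreserving L :=
    ⟨(LinearMap.continuous_of_finiteDimensional L).measurable, by
      rw [Measure.map_linearMap_addHaar_eq_smul_addHaar _ hne, habs]; simp⟩
  have h2 : (fun y : Fin k → ℝ => Function.update y m (1 - ∑ i, y i)) =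
      (fun x => x + Pi.single m (1 : ℝ)) ∘ L := by
    funext y i
    rcases eq_or_ne i m with rfl | h
    · simp [L]; ring
    · simp [L, h]
  rw [h2]
  exact (measurePreserving_add_right volume (Pi.single m (1 : ℝ))).comp h1

theorem sum_swap {k : ℕ} (m : Fin k) (y : Fin k → ℝ) :
    ∑ i, Function.update y m (1 - ∑ i, y i) i = 1 - y m := by
  rw [Finset.sum_update_of_mem (Finset.mem_univ _)]
  have := Finset.sum_erase_add Finset.univ y (Finset.mem_univ m)
  rw [Finset.sdiff_singleton_eq_erase]; linarith

theorem setIntegral_slant {k : ℕ} (j : Fin (k + 1)) (a : (Fin (k + 1) → ℝ) → ℝ) :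
    ∫ y in solidSimplex k, a (j.insertNth (1 - ∑ i, y i) y) =
      ∫ y in solidSimplex k, a (bary y) := by
  induction j using Fin.induction with
  | zero => simp [bary]
  | succ m ih =>
    rw [← ih]
    have hmp := measurePreserving_swap m
    have hinv : Function.Involutive
        (fun y : Fin k → ℝ => Function.update y m (1 - ∑ i, y i)) := by
      intro y
      simp only [sum_swap]
      simp
    have hemb : MeasurableEmbedding
        (fun y : Fin k → ℝ => Function.update y m (1 - ∑ i, y i)) :=
      (MeasurableEquiv.mk hinv.toPerm hmp.measurable hmp.measurable).measurableEmbedding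
    rw [← hmp.setIntegral_preimage_emb hemb]
    have hpre : (fun y : Fin k → ℝ => Function.update y m (1 - ∑ i, y i)) ⁻¹' solidSimplex k =
        solidSimplex k := by
      have hsub : ∀ y ∈ solidSimplex k,
          Function.update y m (1 - ∑ i, y i) ∈ solidSimplex k := by
        intro y hy
        refine ⟨fun i => ?_, ?_⟩
        · rcases eq_or_ne i m with rfl | h
          · simp [hy.2]
          · simp [h, hy.1 i]
        · rw [sum_swap]; linarith [hy.1 m]
      ext y
      refine ⟨fun h => ?_, hsub y⟩
      have := hsub _ h
      rwa [show Function.update _ m _ = _ from hinv y] at this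
    rw [hpre]
    refine integral_congr_ae (Filter.Eventually.of_forall fun y => ?_)
    dsimp only
    rw [sum_swap]
    congr 1
    ext i
    induction i using Fin.succAboveCases m.castSucc with
    | x =>
      have h : m.castSucc = m.succ.succAbove m := by simp
      rw [Fin.insertNth_apply_same, h, Fin.insertNth_apply_succAbove]
      simp
    | p i =>
      rw [Fin.insertNth_apply_succAbove]
      rcases eq_or_ne i m with rfl | h
      · rw [Fin.succAbove_castSucc_self, Fin.insertNth_apply_same]
        ring
      · have h' : m.castSucc.succAbove i = m.succ.succAbove i := by
          rcases lt_or_gt_of_ne h with h | h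
          · rw [Fin.succAbove_castSucc_of_lt _ _ h, Fin.succAbove_succ_of_le _ _ h.le]
          · rw [Fin.succAbove_castSucc_of_le _ _ h.le, Fin.succAbove_succ_of_lt _ _ h]
        rw [h', Fin.insertNth_apply_succAbove, Function.update_of_ne h]


theorem alternating_sub_first {k : ℕ} (f : (Fin (k + 1) → ℝ) [⋀^Fin k]→ₗ[ℝ] ℝ) :
    f (fun m => Pi.single m.succ 1 - Pi.single 0 1) =
      ∑ j : Fin (k + 1), (-1 : ℝ) ^ (j : ℕ) * f (fun i => Pi.single (j.succAbove i) 1) := by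
  let l : (Fin (k + 1) → ℝ) →ₗ[ℝ] ℝ := ∑ i, LinearMap.proj i
  have hl : ∀ i, l (Pi.single i 1) = 1 := fun i => by simp [l]
  let F := AlternatingMap.alternatizeUncurryFin (l.smulRight f)
  let v : Fin (k + 1) → Fin (k + 1) → ℝ := fun i => Pi.single i 1
  let w : Finset (Fin k) → Fin (k + 1) → Fin (k + 1) → ℝ := fun s =>
    Fin.cons (v 0) fun m => if m ∈ s then v m.succ - v 0 else v m.succ
  have hw : ∀ s, F (w s) = F v := by
    intro s
    induction s using Finset.induction_on with
    | empty => congr 1; ext i : 1; refine Fin.cases ?_ (fun m => ?_) i <;> simp [w]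
    | insert m s hm ih =>
      have h1 : w (insert m s) = Function.update (w s) m.succ (w s m.succ - w s 0) := by
        ext i : 1
        refine Fin.cases ?_ (fun n => ?_) i
        · rw [Function.update_of_ne (Fin.succ_ne_zero m).symm]; simp [w]
        · rcases eq_or_ne n m with rfl | h
          · simp [w, hm]
          · rw [Function.update_of_ne (by simpa using h)]
            simp [w, h]
      rw [h1, AlternatingMap.map_update_sub, Function.update_eq_self,
        AlternatingMap.map_update_self _ _ (Fin.succ_ne_zero m), sub_zero, ih]
  have h1 : F v = ∑ j : Fin (k + 1), (-1 : ℝ) ^ (j : ℕ) * f (j.removeNth v) := by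
    simp [F, AlternatingMap.alternatizeUncurryFin_apply, v, hl]
  have h2 : F (w Finset.univ) = f (fun m => v m.succ - v 0) := by
    have hw0 : w Finset.univ = Fin.cons (v 0) fun m => v m.succ - v 0 := by simp [w]
    rw [hw0]
    simp only [F, AlternatingMap.alternatizeUncurryFin_apply]
    rw [Fin.sum_univ_succ]
    simp only [Fin.cons_zero, Fin.cons_succ, Fin.removeNth_zero, Fin.tail_cons]
    simp [v, hl]
  exact h2.symm.trans ((hw _).trans h1)

/-- Stokes on the solid simplex for a closed form; it is needed to see that integration of a constant
form is well defined on the homology of the torus. -/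
theorem stokes_solidSimplex {k : ℕ}
    (η : (Fin (k + 1) → ℝ) → (Fin (k + 1) → ℝ) [⋀^Fin k]→L[ℝ] ℝ)
    (hη : Differentiable ℝ η) (hη' : ∀ v, ContDiff ℝ 1 fun x => η x v) (hd : ∀ x, extDeriv η x = 0) :
    (∫ y in solidSimplex k, η (bary y) fun m => Pi.single m.succ 1 - Pi.single 0 1) =
      ∑ j : Fin (k + 1), (-1 : ℝ) ^ (j : ℕ) * ∫ y in solidSimplex k,
        η (j.insertNth 0 y) (fun i => Pi.single (j.succAbove i) 1) := by
  let e : Fin (k + 1) → Fin (k + 1) → ℝ := fun i => Pi.single i 1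
  let a : Fin (k + 1) → (Fin (k + 1) → ℝ) → ℝ := fun j x => η x (j.removeNth e)
  have ha : ∀ j, ContDiff ℝ 1 (a j) := fun j => hη' _
  have hb : Continuous (bary : (Fin k → ℝ) → _) := by
    refine continuous_pi fun i => Fin.cases ?_ (fun m => ?_) i
    · simp only [bary, Fin.cons_zero]; fun_prop
    · simp only [bary, Fin.cons_succ]; fun_prop
  have hint : ∀ {g : (Fin k → ℝ) → ℝ}, Continuous g → IntegrableOn g (solidSimplex k) :=
    fun hg => hg.continuousOn.integrableOn_compact (isCompact_solidSimplex _)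
  have hins : ∀ (j : Fin (k + 1)) (y : Fin k → ℝ) (t : ℝ),
      HasDerivAt (fun t : ℝ => (j.insertNth t y : Fin (k + 1) → ℝ)) (e j) t := by
    intro j y t
    rw [hasDerivAt_pi]
    intro i
    induction i using Fin.succAboveCases j with
    | x => simpa [e] using hasDerivAt_id' t
    | p i => simpa [e] using hasDerivAt_const t (y i)
  have hinsc : ∀ (j : Fin (k + 1)), Continuous
      (fun p : ℝ × (Fin k → ℝ) => (j.insertNth p.1 p.2 : Fin (k + 1) → ℝ)) := by
    intro j
    refine continuous_pi fun i => ?_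
    induction i using Fin.succAboveCases j with
    | x => simpa using continuous_fst
    | p i => simp only [Fin.insertNth_apply_succAbove]; fun_prop
  have step : ∀ j, ∫ x in solidSimplex (k + 1), fderiv ℝ (a j) x (e j) =
      (∫ y in solidSimplex k, a j (bary y)) - ∫ y in solidSimplex k, a j (j.insertNth 0 y) := by
    intro j
    have hc : Continuous fun x => fderiv ℝ (a j) x (e j) :=
      ((ha j).continuous_fderiv one_ne_zero).clm_apply continuous_const
    rw [setIntegral_solidSimplex_succ j _ hc, ← setIntegral_slant j, ← integral_sub]
    · refine integral_congr_ae (Filter.Eventually.of_forall fun y => ?_)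
      dsimp only
      refine intervalIntegral.integral_eq_sub_of_hasDerivAt
        (f := fun t => a j (j.insertNth t y)) (fun t _ => ?_) ?_
      · exact (((ha j).differentiable one_ne_zero _).hasFDerivAt).comp_hasDerivAt t (hins j y t)
      · refine Continuous.intervalIntegrable ?_ _ _
        exact hc.comp ((hinsc j).comp (by fun_prop : Continuous fun t : ℝ => (t, y)))
    · exact hint ((ha j).continuous.comp ((hinsc j).comp
        (by fun_prop : Continuous fun y : Fin k → ℝ => (1 - ∑ i, y i, y))))
    · exact hint ((ha j).continuous.comp ((hinsc j).comp
        (by fun_prop : Continuous fun y : Fin k → ℝ => ((0 : ℝ), y))))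
  have hsum : ∑ j : Fin (k + 1), (-1 : ℝ) ^ (j : ℕ) *
      ∫ x in solidSimplex (k + 1), fderiv ℝ (a j) x (e j) = 0 := by
    simp_rw [← integral_const_mul]
    rw [← integral_finsetSum]
    · refine (integral_congr_ae (Filter.Eventually.of_forall fun x => ?_)).trans (integral_zero _ _)
      have h := congrArg (fun f => f e) (hd x)
      rw [extDeriv_apply (hη x)] at h
      simpa [a] using h
    · intro j _
      exact (continuous_const.mul (((ha j).continuous_fderiv one_ne_zero).clm_apply
        continuous_const)).continuousOn.integrableOn_compact (isCompact_solidSimplex _)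
  have hface : (∫ y in solidSimplex k, η (bary y) fun m => Pi.single m.succ 1 - Pi.single 0 1) =
      ∑ j : Fin (k + 1), (-1 : ℝ) ^ (j : ℕ) * ∫ y in solidSimplex k, a j (bary y) := by
    simp_rw [← integral_const_mul]
    rw [← integral_finsetSum]
    · refine integral_congr_ae (Filter.Eventually.of_forall fun y => ?_)
      exact alternating_sub_first (η (bary y)).toAlternatingMap
    · intro j _
      exact hint (continuous_const.mul ((ha j).continuous.comp hb))
  rw [hface, ← sub_eq_zero, ← Finset.sum_sub_distrib]
  refine Eq.trans (Finset.sum_congr rfl fun j _ => ?_) hsum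
  rw [step j, ← mul_sub]
  rfl

universe u v

/-- A semi-simplicial set (a Δ-set): a contravariant functor from the category of the ordered sets
`{0, …, n}` and strictly increasing maps. `X n` is the set of `n`-simplices. -/
structure SemiSimplicialSet : Type (u + 1) where
  X : ℕ → Type u
  map : ∀ {m n : ℕ}, (Fin (m + 1) ↪o Fin (n + 1)) → X n → X m
  map_refl : ∀ {n : ℕ} (s : X n), map (RelEmbedding.refl _) s = s
  map_trans : ∀ {l m n : ℕ} (θ : Fin (l + 1) ↪o Fin (m + 1)) (φ : Fin (m + 1) ↪o Fin (n + 1))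
    (s : X n), map (θ.trans φ) s = map θ (map φ s)

namespace SemiSimplicialSet

section Homology

variable (S : SemiSimplicialSet.{u}) (R : Type*) [CommRing R]

/-- The `i`-th face map, omitting the vertex `i`. -/
def face {n : ℕ} (i : Fin (n + 2)) (s : S.X (n + 1)) : S.X n :=
  S.map (Fin.succAboveOrderEmb i) s

/-- The module of simplicial `k`-chains with coefficients in `R`. -/
def Chains (k : ℕ) : Type _ := S.X k →₀ R

noncomputable instance (k : ℕ) : AddCommGroup (S.Chains R k) :=
  inferInstanceAs (AddCommGroup (S.X k →₀ R))

noncomputable instance (k : ℕ) : Module R (S.Chains R k) :=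
  inferInstanceAs (Module R (S.X k →₀ R))

variable {S R} in
/-- The coefficient of a simplex in a chain. -/
def coeff {k : ℕ} (c : S.Chains R k) (s : S.X k) : R := (show S.X k →₀ R from c) s

variable {S} in
/-- The chain `r • s`. -/
noncomputable def single {k : ℕ} (s : S.X k) (r : R) : S.Chains R k := Finsupp.single s r

/-- Linear extension to chains of a map defined on simplices. -/
noncomputable def extend {A : Type*} [AddCommGroup A] [Module R A] {k : ℕ} (φ : S.X k → A) :
    S.Chains R k →ₗ[R] A :=
  Finsupp.linearCombination R φ

variable {S R} in
@[simp]
theorem extend_single {A : Type*} [AddCommGroup A] [Module R A] {k : ℕ} (φ : S.X k → A)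
    (s : S.X k) (r : R) : S.extend R φ (single R s r) = r • φ s :=
  Finsupp.linearCombination_single R r s

variable {S R} in
theorem chains_hom_ext {A : Type*} [AddCommGroup A] [Module R A] {k : ℕ}
    {f g : S.Chains R k →ₗ[R] A} (h : ∀ s, f (single R s 1) = g (single R s 1)) : f = g :=
  Finsupp.lhom_ext' fun s => LinearMap.ext_ring (h s)

/-- The boundary operator `∂ s = ∑ (-1)^i d_i s`. -/
noncomputable def boundary (k : ℕ) : S.Chains R (k + 1) →ₗ[R] S.Chains R k :=
  S.extend R fun s => ∑ i : Fin (k + 2), (-1 : R) ^ (i : ℕ) • single R (S.face i s) 1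

/-- The cycles `Z_k`. -/
noncomputable def cycles : ∀ k : ℕ, Submodule R (S.Chains R k)
  | 0 => ⊤
  | k + 1 => LinearMap.ker (S.boundary R k)

/-- The boundaries in degree `k`. -/
noncomputable def boundaries (k : ℕ) : Submodule R (S.Chains R k) :=
  LinearMap.range (S.boundary R k)

/-- The homology `H_k = Z_k / B_k` with coefficients in `R`. -/
abbrev Homology (k : ℕ) : Type _ := S.cycles R k ⧸ (S.boundaries R k).submoduleOf (S.cycles R k)

variable {S R} in
/-- The homology class of a cycle. -/
noncomputable def homologyClass {k : ℕ} (z : S.cycles R k) : S.Homology R k := Submodule.Quotient.mk z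

theorem boundary_single (k : ℕ) (s : S.X (k + 1)) :
    S.boundary R k (single R s 1) =
      ∑ i : Fin (k + 2), (-1 : R) ^ (i : ℕ) • single R (S.face i s) 1 := by
  rw [boundary, extend_single, one_smul]

end Homology

/-- A semi-simplicial map. -/
structure Hom (S : SemiSimplicialSet.{u}) (T : SemiSimplicialSet.{v}) where
  app : ∀ k : ℕ, S.X k → T.X k
  naturality : ∀ {m n : ℕ} (θ : Fin (m + 1) ↪o Fin (n + 1)) (s : S.X n),
    app m (S.map θ s) = T.map θ (app n s)

namespace Hom

variable {S : SemiSimplicialSet.{u}} {T : SemiSimplicialSet.{v}} (f : S.Hom T)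
  (R : Type*) [CommRing R]

noncomputable def chainMap (k : ℕ) : S.Chains R k →ₗ[R] T.Chains R k :=
  S.extend R fun s => single R (f.app k s) 1

theorem chainMap_boundary (k : ℕ) (c : S.Chains R (k + 1)) :
    f.chainMap R k (S.boundary R k c) = T.boundary R k (f.chainMap R (k + 1) c) := by
  refine LinearMap.congr_fun (f := f.chainMap R k ∘ₗ S.boundary R k)
    (g := T.boundary R k ∘ₗ f.chainMap R (k + 1)) (chains_hom_ext fun s => ?_) c
  simp only [LinearMap.comp_apply, boundary_single, map_sum, map_smul, chainMap, extend_single,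
    one_smul]
  simp only [face, f.naturality]

theorem chainMap_mem_cycles (k : ℕ) (c : S.Chains R k) (hc : c ∈ S.cycles R k) :
    f.chainMap R k c ∈ T.cycles R k := by
  cases k with
  | zero => exact Submodule.mem_top
  | succ k =>
    change T.boundary R k _ = 0
    rw [← chainMap_boundary, show S.boundary R k c = 0 from hc, map_zero]

/-- The map induced in homology by a semi-simplicial map. -/
noncomputable def homologyMap (k : ℕ) : S.Homology R k →ₗ[R] T.Homology R k :=
  Submodule.mapQ _ _ ((f.chainMap R k).restrict (f.chainMap_mem_cycles R k)) (by
    rintro ⟨z, hz⟩ ⟨c, hc⟩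
    exact ⟨f.chainMap R (k + 1) c, by
      rw [← chainMap_boundary, hc]; rfl⟩)

end Hom

section Realization

variable (S : SemiSimplicialSet.{u})

/-- The gluing relation of the geometric realization: `(θ^* s, t) ~ (s, θ_* t)`. -/
inductive Glue : (Σ n, S.X n × stdSimplex ℝ (Fin (n + 1))) →
    (Σ n, S.X n × stdSimplex ℝ (Fin (n + 1))) → Prop
  | glue {m n : ℕ} (θ : Fin (m + 1) ↪o Fin (n + 1)) (s : S.X n) (t : stdSimplex ℝ (Fin (m + 1))) :
    Glue ⟨m, S.map θ s, t⟩ ⟨n, s, stdSimplex.map θ t⟩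

/-- The geometric realization `|S|`, the quotient of the disjoint union of the closed simplices
`{s} × Δ^n` by the gluing relation. -/
def Realization : Type u := Quot S.Glue

variable {S}

/-- The characteristic map `Δ^n → |S|` of the simplex `s`. -/
def char {n : ℕ} (s : S.X n) (t : stdSimplex ℝ (Fin (n + 1))) : S.Realization :=
  Quot.mk _ ⟨n, s, t⟩

theorem char_map {m n : ℕ} (θ : Fin (m + 1) ↪o Fin (n + 1)) (s : S.X n)
    (t : stdSimplex ℝ (Fin (m + 1))) : char (S.map θ s) t = char s (stdSimplex.map θ t) :=
  Quot.sound (Glue.glue θ s t)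

/-- The quotient topology, that is, the final topology for all the characteristic maps. -/
instance : TopologicalSpace S.Realization :=
  ⨆ p : Σ n, S.X n, TopologicalSpace.coinduced (char p.2) inferInstance

/-- The open simplex `|s| ⊆ |S|`. -/
def openSimplex {n : ℕ} (s : S.X n) : Set S.Realization :=
  char s '' {t | ∀ i, 0 < t i}

end Realization

section Edges

variable {S : SemiSimplicialSet.{u}}

def vertexEmb {n : ℕ} (i : Fin (n + 1)) : Fin (0 + 1) ↪o Fin (n + 1) :=
  OrderEmbedding.ofStrictMono (fun _ => i) fun a b h => absurd h (by omega)

def edgeEmb {n : ℕ} (i j : Fin (n + 1)) (h : i < j) : Fin (1 + 1) ↪o Fin (n + 1) :=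
  OrderEmbedding.ofStrictMono ![i, j] fun a b hab => by
    fin_cases a <;> fin_cases b
    · exact absurd hab (lt_irrefl _)
    · exact h
    · exact absurd hab (by decide)
    · exact absurd hab (lt_irrefl _)

/-- The `i`-th vertex of `s`. -/
def vertex {n : ℕ} (s : S.X n) (i : Fin (n + 1)) : S.X 0 := S.map (vertexEmb i) s

/-- The edge of `s` from its vertex `i` to its vertex `j`. -/
def edge {n : ℕ} (s : S.X n) (i j : Fin (n + 1)) (h : i < j) : S.X 1 := S.map (edgeEmb i j h) s

/-- The value of `φ` on the edge of `s` from its vertex `0` to its vertex `j` (and `0` for `j = 0`). -/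
noncomputable def edgeVec {A : Type*} [AddCommGroup A] (φ : S.Chains ℤ 1 →+ A) {n : ℕ}
    (s : S.X n) (j : Fin (n + 1)) : A :=
  if h : 0 < j then φ (single ℤ (edge s 0 j h) 1) else 0

theorem vertex_map {m n : ℕ} (θ : Fin (m + 1) ↪o Fin (n + 1)) (s : S.X n) (i : Fin (m + 1)) :
    vertex (S.map θ s) i = vertex s (θ i) := by
  rw [vertex, ← S.map_trans]; rfl

theorem edge_map {m n : ℕ} (θ : Fin (m + 1) ↪o Fin (n + 1)) (s : S.X n) (i j : Fin (m + 1))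
    (h : i < j) : edge (S.map θ s) i j h = edge s (θ i) (θ j) (θ.strictMono h) := by
  rw [edge, ← S.map_trans, edge]
  congr 1
  ext a
  fin_cases a <;> rfl

theorem boundary_edge {n : ℕ} (s : S.X n) (i j : Fin (n + 1)) (h : i < j) :
    S.boundary ℤ 0 (single ℤ (edge s i j h) 1) =
      single ℤ (vertex s j) 1 - single ℤ (vertex s i) 1 := by
  have h0 : S.face 0 (edge s i j h) = vertex s j := by
    rw [face, edge, ← S.map_trans, vertex]
    congr 1
    ext a
    fin_cases a
    rfl
  have h1 : S.face 1 (edge s i j h) = vertex s i := by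
    rw [face, edge, ← S.map_trans, vertex]
    congr 1
    ext a
    fin_cases a
    rfl
  rw [boundary_single, Fin.sum_univ_two, h0, h1]
  simp only [Fin.val_zero, Fin.val_one, pow_zero, pow_one]
  abel

def triangleEmb {n : ℕ} (i j l : Fin (n + 1)) (hij : i < j) (hjl : j < l) :
    Fin (2 + 1) ↪o Fin (n + 1) :=
  OrderEmbedding.ofStrictMono ![i, j, l] (by
    rw [Fin.strictMono_iff_lt_succ]
    intro a
    fin_cases a
    · exact hij
    · exact hjl)

theorem boundary_triangle {n : ℕ} (s : S.X n) (i j l : Fin (n + 1)) (hij : i < j) (hjl : j < l) :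
    S.boundary ℤ 1 (single ℤ (S.map (triangleEmb i j l hij hjl) s) 1) =
      single ℤ (edge s j l hjl) 1 - single ℤ (edge s i l (hij.trans hjl)) 1 +
        single ℤ (edge s i j hij) 1 := by
  have h0 : S.face 0 (S.map (triangleEmb i j l hij hjl) s) = edge s j l hjl := by
    rw [face, edge, ← S.map_trans]
    congr 1
  have h1 : S.face 1 (S.map (triangleEmb i j l hij hjl) s) = edge s i l (hij.trans hjl) := by
    rw [face, edge, ← S.map_trans]
    congr 1
    ext a
    fin_cases a <;> rfl
  have h2 : S.face 2 (S.map (triangleEmb i j l hij hjl) s) = edge s i j hij := by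
    rw [face, edge, ← S.map_trans]
    congr 1
    ext a
    fin_cases a <;> rfl
  rw [boundary_single, Fin.sum_univ_three, h0, h1, h2]
  simp only [Fin.val_zero, Fin.val_one, Fin.val_two, pow_zero, pow_one, neg_one_sq]
  abel

theorem edgeVec_map {A : Type*} [AddCommGroup A] (φ : S.Chains ℤ 1 →+ A)
    (hφ : ∀ {n : ℕ} (s : S.X n) (i j l : Fin (n + 1)) (hij : i < j) (hjl : j < l),
      φ (single ℤ (edge s j l hjl) 1 - single ℤ (edge s i l (hij.trans hjl)) 1 +
        single ℤ (edge s i j hij) 1) = 0)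
    {m n : ℕ} (θ : Fin (m + 1) ↪o Fin (n + 1)) (s : S.X n) (j : Fin (m + 1)) :
    edgeVec φ (S.map θ s) j = edgeVec φ s (θ j) - edgeVec φ s (θ 0) := by
  rcases (Fin.zero_le j).eq_or_lt with rfl | hj
  · simp [edgeVec]
  · have hθ : θ 0 < θ j := θ.strictMono hj
    have hθj : (0 : Fin (n + 1)) < θ j := (Fin.zero_le _).trans_lt hθ
    rw [edgeVec, dif_pos hj, edge_map, edgeVec, dif_pos hθj, edgeVec]
    split_ifs with h0
    · have := hφ s 0 (θ 0) (θ j) h0 hθ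
      rw [map_add, map_sub] at this
      rw [eq_sub_iff_add_eq, ← sub_eq_zero, ← this]
      abel
    · have h0' : θ 0 = 0 := by simpa [Fin.pos_iff_ne_zero] using h0
      simp only [h0', sub_zero]

theorem exists_chain_of_connected {v w : S.X 0}
    (h : Relation.EqvGen (fun a b => ∃ e : S.X 1, vertex e 0 = a ∧ vertex e 1 = b) v w) :
    ∃ c : S.Chains ℤ 1, S.boundary ℤ 0 c = single ℤ w 1 - single ℤ v 1 := by
  induction h with
  | rel a b h =>
    obtain ⟨e, rfl, rfl⟩ := h
    exact ⟨_, boundary_edge e 0 1 (by decide)⟩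
  | refl a => exact ⟨0, by simp⟩
  | symm a b _ ih =>
    obtain ⟨c, hc⟩ := ih
    exact ⟨-c, by rw [map_neg, hc, neg_sub]⟩
  | trans a b c _ _ ih ih' =>
    obtain ⟨c, hc⟩ := ih
    obtain ⟨c', hc'⟩ := ih'
    exact ⟨c + c', by rw [map_add, hc, hc']; abel⟩

end Edges

end SemiSimplicialSet

section Torus

variable {V : Type v} [NormedAddCommGroup V] [NormedSpace ℝ V]

/-- A smooth singular `k`-simplex of the torus `V ⧸ Λ`: a map from the standard simplex that lifts to
a smooth map to `V` (as every map from the simplex that is smooth for the quotient structure does). -/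
structure SmoothSimplex (Λ : Submodule ℤ V) (k : ℕ) where
  toFun : stdSimplex ℝ (Fin (k + 1)) → V ⧸ Λ
  smooth : ∃ g : (Fin (k + 1) → ℝ) → V, ContDiff ℝ ∞ g ∧ ∀ t, toFun t = Λ.mkQ (g t)

theorem SmoothSimplex.ext {Λ : Submodule ℤ V} {k : ℕ} {σ τ : SmoothSimplex Λ k}
    (h : ∀ t, σ.toFun t = τ.toFun t) : σ = τ := by
  cases σ; cases τ
  congr
  exact funext h

/-- The semi-simplicial set of smooth singular simplices of the torus `V ⧸ Λ`. Its homology is the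
(smooth) singular homology of the torus. -/
noncomputable def smoothSingular (Λ : Submodule ℤ V) : SemiSimplicialSet.{v} where
  X := SmoothSimplex Λ
  map θ σ :=
    { toFun := fun t => σ.toFun (stdSimplex.map θ t)
      smooth := by
        obtain ⟨g, hg, h⟩ := σ.smooth
        refine ⟨fun t => g (FunOnFinite.linearMap ℝ ℝ θ t), ?_, fun t => ?_⟩
        · exact hg.comp (LinearMap.toContinuousLinearMap (FunOnFinite.linearMap ℝ ℝ θ)).contDiff
        · rw [h]; rfl }
  map_refl σ := SmoothSimplex.ext fun t => by
    change σ.toFun (stdSimplex.map id t) = _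
    rw [stdSimplex.map_id_apply]
  map_trans θ φ σ := SmoothSimplex.ext fun t => by
    change σ.toFun (stdSimplex.map (φ ∘ θ) t) = _
    rw [← stdSimplex.map_comp_apply]

/-- The integral of the pull-back `g^* η` of a constant form over the standard simplex, parametrized
by the solid simplex. -/
noncomputable def liftIntegral {k : ℕ} (η : V [⋀^Fin k]→L[ℝ] ℝ) (g : (Fin (k + 1) → ℝ) → V) : ℝ :=
  ∫ x in solidSimplex k, η fun i => fderiv ℝ (fun y => g (bary y)) x (Pi.single i 1)

/-- The integral over a smooth singular simplex `σ` of the torus of the form on `V ⧸ Λ` whose pull-back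
to `V` is the constant form `η`. It does not depend on the lift of `σ` (`formIntegral_eq`). -/
noncomputable def formIntegral {Λ : Submodule ℤ V} {k : ℕ} (η : V [⋀^Fin k]→L[ℝ] ℝ)
    (σ : SmoothSimplex Λ k) : ℝ :=
  liftIntegral η σ.smooth.choose

theorem bary_mem {k : ℕ} {x : Fin k → ℝ} (hx : x ∈ solidSimplex k) :
    bary x ∈ stdSimplex ℝ (Fin (k + 1)) := by
  refine ⟨fun i => ?_, ?_⟩
  · refine Fin.cases ?_ (fun m => ?_) i
    · simpa [bary] using hx.2
    · simpa [bary] using hx.1 m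
  · simp [bary, Fin.sum_univ_succ]

theorem contDiff_bary {k : ℕ} : ContDiff ℝ ∞ (bary : (Fin k → ℝ) → _) := by
  rw [contDiff_pi]
  intro i
  refine Fin.cases ?_ (fun m => ?_) i
  · simp only [bary, Fin.cons_zero]; fun_prop
  · simp only [bary, Fin.cons_succ]; fun_prop

theorem liftIntegral_congr {Λ : Submodule ℤ V} [DiscreteTopology Λ] {k : ℕ}
    (η : V [⋀^Fin k]→L[ℝ] ℝ) {g g' : (Fin (k + 1) → ℝ) → V} (hg : ContDiff ℝ ∞ g)
    (hg' : ContDiff ℝ ∞ g') (h : ∀ t ∈ stdSimplex ℝ (Fin (k + 1)), Λ.mkQ (g t) = Λ.mkQ (g' t)) :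
    liftIntegral η g = liftIntegral η g' := by
  have hgb : ContDiff ℝ ∞ fun y : Fin k → ℝ => g (bary y) := hg.comp contDiff_bary
  have hgb' : ContDiff ℝ ∞ fun y : Fin k → ℝ => g' (bary y) := hg'.comp contDiff_bary
  obtain ⟨c, -, hc⟩ := (convex_solidSimplex k).isPreconnected.eqOn_const_of_mapsTo
    (T := (Λ : Set V)) (f := fun y => g (bary y) - g' (bary y))
    ⟨inferInstanceAs (DiscreteTopology Λ)⟩ (hgb.continuous.sub hgb'.continuous).continuousOn
    (fun x hx => by
      have := h _ (bary_mem hx)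
      rwa [Submodule.mkQ_apply, Submodule.mkQ_apply, Submodule.Quotient.eq] at this)
    ⟨0, Λ.zero_mem⟩
  have hae : (interior (solidSimplex k) : Set _) =ᵐ[volume] solidSimplex k :=
    interior_ae_eq_of_null_frontier ((convex_solidSimplex k).addHaar_frontier volume)
  rw [liftIntegral, liftIntegral, ← setIntegral_congr_set hae, ← setIntegral_congr_set hae]
  refine setIntegral_congr_fun isOpen_interior.measurableSet fun x hx => ?_
  have he : (fun y => g (bary y)) =ᶠ[nhds x] fun y => g' (bary y) + c := by
    filter_upwards [isOpen_interior.mem_nhds hx] with y hy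
    rw [← sub_eq_iff_eq_add']
    exact hc (interior_subset hy)
  rw [he.fderiv_eq, fderiv_add_const]

theorem formIntegral_eq {Λ : Submodule ℤ V} [DiscreteTopology Λ] {k : ℕ}
    (η : V [⋀^Fin k]→L[ℝ] ℝ) (σ : SmoothSimplex Λ k) (g : (Fin (k + 1) → ℝ) → V)
    (hg : ContDiff ℝ ∞ g) (h : ∀ t, σ.toFun t = Λ.mkQ (g t)) :
    formIntegral η σ = liftIntegral η g :=
  liftIntegral_congr (Λ := Λ) η σ.smooth.choose_spec.1 hg fun t ht => by
    exact (σ.smooth.choose_spec.2 ⟨t, ht⟩).symm.trans (h ⟨t, ht⟩)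

theorem push_succAbove {n : ℕ} (i : Fin (n + 1)) (t : Fin n → ℝ) :
    FunOnFinite.linearMap ℝ ℝ i.succAbove t = (i.insertNth (0 : ℝ) t : Fin (n + 1) → ℝ) := by
  ext j
  rw [FunOnFinite.linearMap_apply_apply]
  induction j using Fin.succAboveCases i with
  | x => simp [Fin.succAbove_ne]
  | p j => simp [Finset.sum_filter]

theorem push_face_zero {k : ℕ} (y : Fin k → ℝ) :
    FunOnFinite.linearMap ℝ ℝ (Fin.succAbove (0 : Fin (k + 2))) (bary y) =
      bary (bary y) := by
  rw [push_succAbove, Fin.insertNth_zero']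
  simp [bary, Fin.sum_univ_succ]

theorem push_face_succ {k : ℕ} (j : Fin (k + 1)) (y : Fin k → ℝ) :
    FunOnFinite.linearMap ℝ ℝ (Fin.succAbove j.succ) (bary y) =
      bary (j.insertNth (0 : ℝ) y : Fin (k + 1) → ℝ) := by
  rw [push_succAbove, bary, bary, Fin.sum_univ_succAbove _ j]
  simp only [Fin.insertNth_apply_same, Fin.insertNth_apply_succAbove, zero_add]
  exact Fin.insertNth_succ_cons j 0 _ y

noncomputable def baryLinear (k : ℕ) : (Fin k → ℝ) →ₗ[ℝ] (Fin (k + 1) → ℝ) :=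
  FunOnFinite.linearMap ℝ ℝ Fin.succ -
    (∑ i, LinearMap.proj i : (Fin k → ℝ) →ₗ[ℝ] ℝ).smulRight (Pi.single 0 1)

theorem baryLinear_single {k : ℕ} (m : Fin k) :
    baryLinear k (Pi.single m 1) = Pi.single m.succ 1 - Pi.single 0 1 := by
  simp [baryLinear]

theorem hasFDerivAt_bary {k : ℕ} (y : Fin k → ℝ) :
    HasFDerivAt (bary : (Fin k → ℝ) → _) (LinearMap.toContinuousLinearMap (baryLinear k)) y := by
  have h : (bary : (Fin k → ℝ) → _) =
      fun y => LinearMap.toContinuousLinearMap (baryLinear k) y + Pi.single 0 1 := by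
    funext y
    have h2 := push_succAbove 0 y
    rw [Fin.insertNth_zero', Fin.succAbove_zero] at h2
    ext i
    simp only [baryLinear, LinearMap.coe_toContinuousLinearMap', LinearMap.sub_apply, h2]
    refine Fin.cases ?_ (fun m => ?_) i
    · simp [bary]
      ring
    · simp [bary]
  rw [h]
  exact (LinearMap.toContinuousLinearMap (baryLinear k)).hasFDerivAt.add_const _

/-- The integral of a constant form over the boundary of a singular simplex vanishes. -/
theorem formIntegral_boundary {Λ : Submodule ℤ V} [DiscreteTopology Λ] {k : ℕ}
    (η : V [⋀^Fin k]→L[ℝ] ℝ) (σ : SmoothSimplex Λ (k + 1)) :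
    ∑ i : Fin (k + 2), (-1 : ℝ) ^ (i : ℕ) * formIntegral η ((smoothSingular Λ).face i σ) = 0 := by
  obtain ⟨g, hg, hσ⟩ := σ.smooth
  let G : (Fin (k + 1) → ℝ) → V := fun y => g (bary y)
  have hG : ContDiff ℝ ∞ G := hg.comp contDiff_bary
  let Φ : (Fin (k + 1) → ℝ) → (Fin (k + 1) → ℝ) [⋀^Fin k]→L[ℝ] ℝ := fun x =>
    η.compContinuousLinearMap (fderiv ℝ G x)
  have hF : Differentiable ℝ Φ := by
    exact fun x => (differentiableAt_const η).continuousAlternatingMapCompContinuousLinearMap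
      ((hG.fderiv_right (m := 1) (by norm_cast)).differentiable one_ne_zero x)
  have hF2 : ∀ v, ContDiff ℝ 1 fun x => Φ x v := by
    intro v
    refine η.toContinuousMultilinearMap.contDiff.comp (contDiff_pi.2 fun i => ?_)
    exact (hG.fderiv_right (m := 1) (by norm_cast)).clm_apply contDiff_const
  have hd : ∀ x, extDeriv Φ x = 0 := by
    intro x
    have h := extDeriv_pullback (𝕜 := ℝ) (f := G) (x := x) (r := 2)
      (differentiableAt_const η) (hG.contDiffAt.of_le (by norm_cast)) (by simp)
    refine h.trans ?_
    have h0 : extDeriv (fun _ : V => η) (G x) = 0 := by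
      ext v
      simp [extDeriv, ContinuousAlternatingMap.alternatizeUncurryFin_apply]
    rw [h0]
    rfl
  have hface : ∀ i, formIntegral η ((smoothSingular Λ).face i σ) =
      liftIntegral η fun t => g (FunOnFinite.linearMap ℝ ℝ (Fin.succAbove i) t) := by
    intro i
    refine formIntegral_eq η _ _ ?_ fun t => ?_
    · exact hg.comp (LinearMap.toContinuousLinearMap
        (FunOnFinite.linearMap ℝ ℝ (Fin.succAbove i))).contDiff
    · exact hσ _
  have h0 : formIntegral η ((smoothSingular Λ).face 0 σ) =
      ∫ y in solidSimplex k, Φ (bary y) fun m => Pi.single m.succ 1 - Pi.single 0 1 := by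
    rw [hface, liftIntegral]
    refine integral_congr_ae (Filter.Eventually.of_forall fun y => ?_)
    simp only [push_face_zero, Φ, ContinuousAlternatingMap.compContinuousLinearMap_apply]
    congr 1
    ext1 m
    have hc := (hG.differentiable (by simp) (bary y)).hasFDerivAt.comp y (hasFDerivAt_bary y)
    rw [Function.comp_apply, ← baryLinear_single]
    exact congrArg (fun L => L (Pi.single m 1)) hc.fderiv
  have h1 : ∀ j : Fin (k + 1), formIntegral η ((smoothSingular Λ).face j.succ σ) =
      ∫ y in solidSimplex k, Φ (j.insertNth 0 y) fun i => Pi.single (j.succAbove i) 1 := by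
    intro j
    rw [hface, liftIntegral]
    refine integral_congr_ae (Filter.Eventually.of_forall fun y => ?_)
    simp only [push_face_succ, Φ, ContinuousAlternatingMap.compContinuousLinearMap_apply]
    congr 1
    ext1 m
    have hb : HasFDerivAt (fun y : Fin k → ℝ => (j.insertNth (0 : ℝ) y : Fin (k + 1) → ℝ))
        (LinearMap.toContinuousLinearMap
          (FunOnFinite.linearMap ℝ ℝ (Fin.succAbove j))) y := by
      simp only [← push_succAbove]
      exact (LinearMap.toContinuousLinearMap _).hasFDerivAt
    have hc := (hG.differentiable (by simp) _).hasFDerivAt.comp y hb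
    have hbm : FunOnFinite.linearMap ℝ ℝ (Fin.succAbove j) (Pi.single m 1) =
        Pi.single (j.succAbove m) 1 := FunOnFinite.linearMap_piSingle _ _ _ _ _
    rw [Function.comp_apply, ← hbm]
    exact congrArg (fun L => L (Pi.single m 1)) hc.fderiv
  rw [Fin.sum_univ_succ, h0, stokes_solidSimplex Φ hF hF2 hd]
  simp only [h1]
  simp [pow_succ]

/-- Integration of a constant form over smooth singular chains of the torus. -/
noncomputable def formOnChains (Λ : Submodule ℤ V) {k : ℕ} (η : V [⋀^Fin k]→L[ℝ] ℝ) :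
    (smoothSingular Λ).Chains ℝ k →ₗ[ℝ] ℝ :=
  (smoothSingular Λ).extend ℝ fun σ => formIntegral η σ

theorem formOnChains_boundary (Λ : Submodule ℤ V) [DiscreteTopology Λ] {k : ℕ}
    (η : V [⋀^Fin k]→L[ℝ] ℝ) (c : (smoothSingular Λ).Chains ℝ (k + 1)) :
    formOnChains Λ η ((smoothSingular Λ).boundary ℝ k c) = 0 := by
  refine LinearMap.congr_fun (f := formOnChains Λ η ∘ₗ (smoothSingular Λ).boundary ℝ k)
    (g := 0) (SemiSimplicialSet.chains_hom_ext fun σ => ?_) c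
  rw [LinearMap.comp_apply, SemiSimplicialSet.boundary_single, map_sum, LinearMap.zero_apply]
  refine (Finset.sum_congr rfl fun i _ => ?_).trans (formIntegral_boundary η σ)
  rw [map_smul, formOnChains, SemiSimplicialSet.extend_single, one_smul, smul_eq_mul]

/-- The de Rham cohomology class of the constant form `η` on the torus `V ⧸ Λ`, as an element of
`H^k(V ⧸ Λ, ℝ) = Hom(H_k(V ⧸ Λ, ℝ), ℝ)`; the duality is given by integration. -/
noncomputable def constFormClass (Λ : Submodule ℤ V) [DiscreteTopology Λ] {k : ℕ}
    (η : V [⋀^Fin k]→L[ℝ] ℝ) : Module.Dual ℝ ((smoothSingular Λ).Homology ℝ k) :=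
  Submodule.liftQ _ ((formOnChains Λ η).comp (Submodule.subtype _)) (by
    rintro ⟨z, hz⟩ ⟨c, hc⟩
    change formOnChains Λ η z = 0
    change _ = z at hc
    rw [← hc, formOnChains_boundary])

end Torus

open SemiSimplicialSet

/-- A `d`-dimensional flat-branched semi-simplicial complex: a finite connected semi-simplicial set of
dimension `d` with a homomorphism `rho` from its group of `1`-chains to the Euclidean space `E` that
vanishes on boundaries and is linearly independent on the edges of any simplex originating in the
same vertex (it suffices to say this for the vertex `0`, because `rho` vanishes on boundaries).
Connectedness is expressed through edge-paths. -/
structure FBSComplex (d : ℕ) (E : Type v) [NormedAddCommGroup E] [NormedSpace ℝ E] extends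
    SemiSimplicialSet.{u} where
  finite : ∀ k, Finite (X k)
  nonempty_top : Nonempty (X d)
  isEmpty_above : ∀ k, d < k → IsEmpty (X k)
  connected : ∀ v w : X 0, Relation.EqvGen (fun a b => ∃ e : X 1,
    toSemiSimplicialSet.vertex e 0 = a ∧ toSemiSimplicialSet.vertex e 1 = b) v w
  rho : toSemiSimplicialSet.Chains ℤ 1 →+ E
  rho_boundary : ∀ c, rho (toSemiSimplicialSet.boundary ℤ 1 c) = 0
  linearIndependent : ∀ (k : ℕ) (s : X k),
    LinearIndependent ℝ fun j : Fin k => toSemiSimplicialSet.edgeVec rho s j.succ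

namespace FBSComplex

section

variable {d : ℕ} {E : Type v} [NormedAddCommGroup E] [NormedSpace ℝ E] (B : FBSComplex.{u} d E)

/-- The underlying semi-simplicial set. -/
abbrev S : SemiSimplicialSet.{u} := B.toSemiSimplicialSet

/-- The homomorphism `H_1(B, ℤ) → E` induced by `rho` on `1`-cycles. -/
noncomputable def rhoStar : B.S.Homology ℤ 1 →+ E :=
  (Submodule.liftQ ((B.S.boundaries ℤ 1).submoduleOf (B.S.cycles ℤ 1))
    ({ toFun := fun z => B.rho z
       map_add' := fun x y => B.rho.map_add x y
       map_smul' := fun n x => by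
        simp } : B.S.cycles ℤ 1 →ₗ[ℤ] E) (by
    rintro ⟨z, hz⟩ ⟨c, hc⟩
    change _ = z at hc
    change B.rho z = 0
    rw [← hc, B.rho_boundary])).toAddMonoidHom

/-- The affine map from the standard simplex onto the affine simplex of `E` with vertices
`0, ρ(e_1), …, ρ(e_k)`, where `e_i` is the edge of `s` from its vertex `0` to its vertex `i`. On the
open simplex it is the map `α_s` in barycentric coordinates. -/
noncomputable def shape {k : ℕ} (s : B.X k) (t : stdSimplex ℝ (Fin (k + 1))) : E :=
  ∑ j, t j • edgeVec B.rho s j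

/-- The closed affine simplex which is the translate by `a` of the prototile of `s`. -/
def tile (s : B.X d) (a : E) : Set E := {x | ∃ t, x = a + B.shape s t}

/-- The interior of the translate by `a` of the prototile of `s`. -/
def openTile (s : B.X d) (a : E) : Set E := {x | ∃ t, (∀ i, 0 < t i) ∧ x = a + B.shape s t}

/-- An isometric winding of `B`: a continuous map `f : E → |B|` such that the preimage of every open
`d`-simplex `|s|` is a disjoint union of interiors of translated prototiles `a + α_s(|s|)`, where `a`
runs over the set `pos s`, with `α_s(f(x)) = x - a` on the interior of the tile at `a`, and such that
the closed tiles cover `E`. -/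
structure IsometricWinding where
  toFun : E → B.S.Realization
  continuous : Continuous toFun
  pos : B.X d → Set E
  preimage : ∀ s, toFun ⁻¹' openSimplex s = ⋃ a ∈ pos s, B.openTile s a
  disjoint : ∀ s, (pos s).PairwiseDisjoint (B.openTile s)
  translated : ∀ s, ∀ a ∈ pos s, ∀ t : stdSimplex ℝ (Fin (d + 1)), (∀ i, 0 < t i) →
    toFun (a + B.shape s t) = char s t
  cover : ⋃ s, ⋃ a ∈ pos s, B.tile s a = Set.univ

end

section Lifting

variable {d : ℕ} {E : Type*} [NormedAddCommGroup E] [NormedSpace ℝ E] (B : FBSComplex.{u} d E)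
  {V : Type*} [NormedAddCommGroup V] [NormedSpace ℝ V]

/-- The data of a lifting, for the torus `V ⧸ Λ` where `Λ` is a lattice spanning `V = Λ ⊗ ℝ`:
a surjective homomorphism `lam : H_1(B, ℤ) → Λ` through which `rhoStar` factors by the restriction to
`Λ` of the projection `piE`; a homomorphism `rhoLift : C_1(B) → V` with `piE ∘ rhoLift = rho` which is
equal to `lam` on cycles; a base vertex `v₀` and its image `y₀` in `V`. -/
structure Lifting (Λ : Submodule ℤ V) where
  lam : B.S.Homology ℤ 1 →+ Λ
  lam_surjective : Function.Surjective lam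
  piE : V →ₗ[ℝ] E
  piE_lam : ∀ x, piE (lam x) = B.rhoStar x
  rhoLift : B.S.Chains ℤ 1 →+ V
  piE_rhoLift : ∀ c, piE (rhoLift c) = B.rho c
  rhoLift_cycle : ∀ z : B.S.cycles ℤ 1, rhoLift z = lam (homologyClass z)
  v₀ : B.X 0
  y₀ : V

namespace Lifting

variable {B} {Λ : Submodule ℤ V} (D : B.Lifting Λ)

theorem exists_path (v : B.X 0) :
    ∃ c : B.S.Chains ℤ 1, B.S.boundary ℤ 0 c = single ℤ v 1 - single ℤ D.v₀ 1 :=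
  exists_chain_of_connected (B.connected D.v₀ v)

/-- The point `y₀ + rhoLift(v₀ … v)` for a path from `v₀` to `v`; modulo `Λ` it does not depend on
the path. -/
noncomputable def vertexLift (v : B.X 0) : V := D.y₀ + D.rhoLift (D.exists_path v).choose

/-- The image of a vertex in the torus. -/
noncomputable def vertexImage (v : B.X 0) : V ⧸ Λ := Λ.mkQ (D.vertexLift v)

theorem rhoLift_mem (z : B.S.Chains ℤ 1) (hz : B.S.boundary ℤ 0 z = 0) : D.rhoLift z ∈ Λ := by
  rw [D.rhoLift_cycle ⟨z, hz⟩]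
  exact (D.lam _).2

theorem vertexImage_eq {v w : B.X 0} (c : B.S.Chains ℤ 1)
    (hc : B.S.boundary ℤ 0 c = single ℤ w 1 - single ℤ v 1) :
    D.vertexImage w = D.vertexImage v + Λ.mkQ (D.rhoLift c) := by
  rw [vertexImage, vertexImage, ← map_add, Submodule.mkQ_apply, Submodule.mkQ_apply,
    Submodule.Quotient.eq]
  have h := D.rhoLift_mem ((D.exists_path w).choose - (D.exists_path v).choose - c) (by
    rw [map_sub, map_sub, (D.exists_path w).choose_spec, (D.exists_path v).choose_spec, hc]
    abel)
  rw [map_sub, map_sub] at h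
  convert h using 1
  simp only [vertexLift]
  abel

theorem rhoLift_triangle {n : ℕ} (s : B.X n) (i j l : Fin (n + 1)) (hij : i < j) (hjl : j < l) :
    D.rhoLift (single ℤ (edge s j l hjl) 1 - single ℤ (edge s i l (hij.trans hjl)) 1 +
      single ℤ (edge s i j hij) 1) = 0 := by
  have hz : B.S.boundary ℤ 0 (single ℤ (edge s j l hjl) 1 -
      single ℤ (edge s i l (hij.trans hjl)) 1 + single ℤ (edge s i j hij) 1) = 0 := by
    rw [map_add, map_sub, boundary_edge, boundary_edge, boundary_edge]
    abel
  rw [D.rhoLift_cycle ⟨_, hz⟩]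
  have h0 : homologyClass (S := B.S) (R := ℤ) (k := 1) ⟨_, hz⟩ = 0 :=
    (Submodule.Quotient.mk_eq_zero _).2 ⟨_, boundary_triangle s i j l hij hjl⟩
  rw [h0, map_zero]
  rfl

theorem vertexImage_vertex {n : ℕ} (s : B.X n) (j : Fin (n + 1)) :
    D.vertexImage (vertex s j) = D.vertexImage (vertex s 0) + Λ.mkQ (edgeVec D.rhoLift s j) := by
  rw [edgeVec]
  split_ifs with h
  · exact D.vertexImage_eq _ (boundary_edge s 0 j h)
  · have : j = 0 := by simpa [Fin.pos_iff_ne_zero] using h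
    simp [this]

/-- The map `β : |B| → V ⧸ Λ`: vertices are sent to `y₀ + rhoLift(v₀ … v)` modulo `Λ`, and the map is
affine in the barycentric coordinates of every simplex, with the edge `e` lifted to `rhoLift e`. -/
noncomputable def beta : B.S.Realization → V ⧸ Λ :=
  Quot.lift (fun p => D.vertexImage (vertex p.2.1 0) +
    Λ.mkQ (∑ j, p.2.2 j • edgeVec D.rhoLift p.2.1 j)) (by
    rintro _ _ ⟨θ, s, t⟩
    have h1 : ∀ j, edgeVec D.rhoLift (B.S.map θ s) j =
        edgeVec D.rhoLift s (θ j) - edgeVec D.rhoLift s (θ 0) :=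
      edgeVec_map D.rhoLift (fun s i j l hij hjl => D.rhoLift_triangle s i j l hij hjl) θ s
    have h2 : ∑ i, (stdSimplex.map θ t) i • edgeVec D.rhoLift s i =
        ∑ j, t j • edgeVec D.rhoLift s (θ j) := by
      simp only [stdSimplex.map_coe, FunOnFinite.linearMap_apply_apply, Finset.sum_smul]
      rw [← Finset.sum_fiberwise Finset.univ θ]
      refine Finset.sum_congr rfl fun i _ => Finset.sum_congr rfl fun j hj => ?_
      rw [(Finset.mem_filter.1 hj).2]
    change D.vertexImage (vertex (B.S.map θ s) 0) +
        Λ.mkQ (∑ j, t j • edgeVec D.rhoLift (B.S.map θ s) j) =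
      D.vertexImage (vertex s 0) + Λ.mkQ (∑ i, (stdSimplex.map θ t) i • edgeVec D.rhoLift s i)
    rw [vertex_map, D.vertexImage_vertex s (θ 0), h2, add_assoc, ← map_add]
    congr 2
    simp only [h1, smul_sub, Finset.sum_sub_distrib, ← Finset.sum_smul]
    rw [stdSimplex.sum_eq_one, one_smul]
    abel)

theorem beta_char {n : ℕ} (s : B.X n) (t : stdSimplex ℝ (Fin (n + 1))) :
    D.beta (char s t) =
      D.vertexImage (vertex s 0) + Λ.mkQ (∑ j, t j • edgeVec D.rhoLift s j) := rfl

/-- The semi-simplicial map which sends a simplex `s` of `B` to the singular simplex `β ∘ char s`. -/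
noncomputable def betaHom : B.S.Hom (smoothSingular Λ) where
  app k s :=
    { toFun := fun t => D.beta (char s t)
      smooth := ⟨fun t => D.vertexLift (vertex s 0) + ∑ j, t j • edgeVec D.rhoLift s j,
        by fun_prop, fun t => by rw [beta_char, vertexImage, ← map_add]⟩ }
  naturality θ s := SmoothSimplex.ext fun t => congrArg D.beta (char_map θ s t)

/-- The map `β_* : H_k(B, ℝ) → H_k(V ⧸ Λ, ℝ)`. -/
noncomputable def betaStar (k : ℕ) :
    B.S.Homology ℝ k →ₗ[ℝ] (smoothSingular Λ).Homology ℝ k :=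
  D.betaHom.homologyMap ℝ k

end Lifting

end Lifting

section Orientation

variable {d : ℕ} {E : Type*} [NormedAddCommGroup E] [InnerProductSpace ℝ E]
  [FiniteDimensional ℝ E] [Fact (Module.finrank ℝ E = d)] (o : Orientation ℝ E (Fin d))

/-- The volume form `Ω_E`, equal to `1` on positively oriented orthonormal bases. -/
noncomputable def volForm : E [⋀^Fin d]→L[ℝ] ℝ :=
  AlternatingMap.mkContinuous o.volumeForm 1 fun v => by
    rw [one_mul]
    exact o.abs_volumeForm_apply_le v

/-- The class `ω_E ∈ H^d(V ⧸ Λ, ℝ)` of the constant form `piE^* Ω_E`. -/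
noncomputable def Lifting.omegaE {B : FBSComplex.{u} d E} {V : Type*} [NormedAddCommGroup V]
    [NormedSpace ℝ V] [FiniteDimensional ℝ V] {Λ : Submodule ℤ V} [DiscreteTopology Λ]
    (D : B.Lifting Λ) : Module.Dual ℝ ((smoothSingular Λ).Homology ℝ d) :=
  constFormClass Λ ((volForm o).compContinuousLinearMap (LinearMap.toContinuousLinearMap D.piE))

variable (B : FBSComplex.{u} d E)

/-- The sign `ε(s)` such that `ε(s) s` is positively oriented: the sign of the orientation that `E`
induces on the simplex `s` with its ordered vertices. -/
noncomputable def orientSign (s : B.X d) : ℝ :=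
  SignType.sign (o.volumeForm fun j : Fin d => edgeVec B.rho s j.succ)

/-- The closed positive cone `Z_d^+(B, ℝ)`: the real `d`-cycles with non-negative coefficients in the
basis of positively oriented simplices. -/
def positiveCycles : Set (B.S.cycles ℝ d) :=
  {z | ∀ s : B.X d, 0 ≤ B.orientSign o s * coeff (z : B.S.Chains ℝ d) s}

variable {B}

/-- The chain `f_*(P_r)`, where `P_r` is the sum of the positively oriented tiles contained in the
open ball of radius `r` centered at `0`. -/
noncomputable def IsometricWinding.patchChain (f : B.IsometricWinding) (r : ℝ) : B.S.Chains ℝ d :=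
  haveI := B.finite d
  (Finsupp.equivFunOnFinite.symm fun s : B.X d =>
    B.orientSign o s * ({a ∈ f.pos s | B.tile s a ⊆ Metric.ball 0 r}.ncard : ℝ) : B.X d →₀ ℝ)

/-- The chain `c_r = f_*(P_r) / vol(B_r)`. -/
noncomputable def IsometricWinding.normalizedPatch [MeasurableSpace E] [BorelSpace E]
    (f : B.IsometricWinding) (r : ℝ) : B.S.Chains ℝ d :=
  (MeasureTheory.volume.real (Metric.ball (0 : E) r))⁻¹ • f.patchChain o r

end Orientation

end FBSComplex

end FBS

/-! Tiles of one type have disjoint interiors of equal positive volume. The number of tiles of a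
type inside the ball, divided by the volume of the ball, is therefore bounded, and the chains `c_r`
have an accumulation point `z` (`exists_mapClusterPt`). What has to be shown about `z` consists of
closed conditions on its coefficients, so it is enough to know them along `c_r`, exactly or in the
limit.

Positivity holds for every `c_r`. For the pairing with `ω_E`, the map `β` is affine on each simplex
and `π_E` sends its edges back to the edges of the prototile. Hence `ω_E ∘ β_*` is the signed volume
of a cycle (`omegaE_betaStar`). The tiles inside a ball miss only a shell of bounded width and a
null set, and the volume of that shell is negligible, so the signed volume of `c_r` tends to `1`
(`tendsto_coeff_volume`).

The main point is that `z` is a cycle. No adjacency of tiles across faces is analysed; a test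
function on `|B|` replaces the cancellation of inner faces. For a `(d-1)`-simplex `u`, the function
`faceWeight u` is, on each simplex, the sum over the faces equal to `u` of the product of the
barycentric coordinates of the vertices of that face. It is continuous on `|B|`, and its pull-back
`F` by the winding is bounded and Lipschitz on `E` (`exists_lipschitz_bounded`). The mean of the
directional derivative of `F` along a fixed vector `n` is computed in two ways.

Integration by parts against a cutoff shows that the mean over large balls tends to `0`
(`tendsto_average_lineDeriv`). On a tile of type `s`, each summand of the weight vanishes on all
facets but one, so the divergence theorem gives a positive constant, times the flux of `n` through
`u`, times the oriented incidence number of `s` and `u` (`setIntegral_fderiv_facePoly`). Adding over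
the tiles gives that constant and that flux times the coefficient of `∂c_r` at `u`. If `u` is a face
of some `d`-simplex, `n` can be chosen with non-zero flux, so the coefficient tends to `0`
(`tendsto_coeff_boundary`). -/

namespace FBS

open MeasureTheory Set
open scoped ContDiff

universe u

/-! ### Integrals of derivatives over the solid simplex. -/

section SolidSimplex

/-- The interior of the solid simplex. -/
def openSolidSimplex (k : ℕ) : Set (Fin k → ℝ) := {x | (∀ i, 0 < x i) ∧ ∑ i, x i < 1}

theorem openSolidSimplex_subset (k : ℕ) : openSolidSimplex k ⊆ solidSimplex k :=
  fun _ hx => ⟨fun i => (hx.1 i).le, hx.2.le⟩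

theorem isOpen_openSolidSimplex (k : ℕ) : IsOpen (openSolidSimplex k) := by
  have : openSolidSimplex k = (⋂ i, {x : Fin k → ℝ | 0 < x i}) ∩ {x | ∑ i, x i < 1} := by
    ext x; simp [openSolidSimplex]
  rw [this]
  refine (isOpen_iInter_of_finite fun i => ?_).inter ?_
  · exact isOpen_lt continuous_const (continuous_apply i)
  · exact isOpen_lt (by fun_prop) continuous_const

theorem openSolidSimplex_nonempty (k : ℕ) : (openSolidSimplex k).Nonempty := by
  refine ⟨fun _ => ((k : ℝ) + 1)⁻¹, fun i => by positivity, ?_⟩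
  simp only [Finset.sum_const, Finset.card_univ, Fintype.card_fin, nsmul_eq_mul]
  rw [← div_eq_mul_inv, div_lt_one (by positivity)]
  linarith

theorem combo_mem_openSolidSimplex {k : ℕ} {x y : Fin k → ℝ} (hx : x ∈ solidSimplex k)
    (hy : y ∈ openSolidSimplex k) {a b : ℝ} (ha : 0 ≤ a) (hb : 0 < b) (hab : a + b = 1) :
    a • x + b • y ∈ openSolidSimplex k := by
  refine ⟨fun i => ?_, ?_⟩
  · have := hx.1 i; have := hy.1 i
    simp only [Pi.add_apply, Pi.smul_apply, smul_eq_mul]; positivity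
  · simp only [Pi.add_apply, Pi.smul_apply, smul_eq_mul, Finset.sum_add_distrib, ← Finset.mul_sum]
    nlinarith [hx.2, hy.2, mul_le_mul_of_nonneg_left hx.2 ha, mul_lt_mul_of_pos_left hy.2 hb]

theorem convex_openSolidSimplex (k : ℕ) : Convex ℝ (openSolidSimplex k) := by
  intro x hx y hy a b ha hb hab
  rcases hb.eq_or_lt with rfl | hb
  · rw [add_zero] at hab
    simpa [hab] using hx
  · exact combo_mem_openSolidSimplex (openSolidSimplex_subset k hx) hy ha hb hab

theorem solidSimplex_subset_closure (k : ℕ) : solidSimplex k ⊆ closure (openSolidSimplex k) := by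
  intro x hx
  obtain ⟨y, hy⟩ := openSolidSimplex_nonempty k
  have hc : Filter.Tendsto (fun t : ℝ => (1 - t) • x + t • y) (nhdsWithin 0 (Ioi 0))
      (nhds ((1 - (0 : ℝ)) • x + (0 : ℝ) • y)) :=
    ((by fun_prop : Continuous fun t : ℝ => (1 - t) • x + t • y).tendsto 0).mono_left
      nhdsWithin_le_nhds
  simp only [sub_zero, one_smul, zero_smul, add_zero] at hc
  refine mem_closure_of_tendsto hc ?_
  filter_upwards [Ioo_mem_nhdsGT zero_lt_one] with t ht
  exact combo_mem_openSolidSimplex hx hy (by linarith [ht.2]) ht.1 (by ring)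

theorem openSolidSimplex_ae_eq (k : ℕ) :
    openSolidSimplex k =ᵐ[volume] solidSimplex k := by
  refine (LE.le.eventuallyLE (openSolidSimplex_subset k)).antisymm ?_
  rw [ae_le_set]
  refine measure_mono_null (fun x hx => ?_) ((convex_openSolidSimplex k).addHaar_frontier volume)
  rw [(isOpen_openSolidSimplex k).frontier_eq]
  exact ⟨solidSimplex_subset_closure k hx.1, hx.2⟩

theorem volume_solidSimplex_pos (k : ℕ) : 0 < volume.real (solidSimplex k) := by
  refine ENNReal.toReal_pos (ne_of_gt ?_) (isCompact_solidSimplex k).measure_ne_top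
  exact ((isOpen_openSolidSimplex k).measure_pos volume (openSolidSimplex_nonempty k)).trans_le
    (measure_mono (openSolidSimplex_subset k))

theorem bary_pos {k : ℕ} {x : Fin k → ℝ} (hx : x ∈ openSolidSimplex k) (i : Fin (k + 1)) :
    0 < bary x i := by
  refine Fin.cases ?_ (fun m => ?_) i
  · simpa [bary] using hx.2
  · simpa [bary] using hx.1 m

theorem continuous_bary {k : ℕ} : Continuous (bary : (Fin k → ℝ) → _) :=
  contDiff_bary.continuous

/-- A line in the direction of coordinate `j` enters the simplex through the facet where this
coordinate is zero and leaves it through the slanted facet. The formula is the fundamental theorem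
of calculus on these lines; `setIntegral_slant` removes the dependence on `j` from the
parametrization of the slanted facet. -/
theorem setIntegral_partialDeriv {k : ℕ} (j : Fin (k + 1)) (a : (Fin (k + 1) → ℝ) → ℝ)
    (ha : ContDiff ℝ 1 a) :
    ∫ x in solidSimplex (k + 1), fderiv ℝ a x (Pi.single j 1) =
      (∫ y in solidSimplex k, a (bary y)) - ∫ y in solidSimplex k, a (j.insertNth 0 y) := by
  have hint : ∀ {g : (Fin k → ℝ) → ℝ}, Continuous g → IntegrableOn g (solidSimplex k) :=
    fun hg => hg.continuousOn.integrableOn_compact (isCompact_solidSimplex _)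
  have hins : ∀ (y : Fin k → ℝ) (t : ℝ),
      HasDerivAt (fun t : ℝ => (j.insertNth t y : Fin (k + 1) → ℝ)) (Pi.single j 1) t := by
    intro y t
    rw [hasDerivAt_pi]
    intro i
    induction i using Fin.succAboveCases j with
    | x => simpa using hasDerivAt_id' t
    | p i => simpa using hasDerivAt_const t (y i)
  have hinsc : Continuous
      (fun p : ℝ × (Fin k → ℝ) => (j.insertNth p.1 p.2 : Fin (k + 1) → ℝ)) := by
    refine continuous_pi fun i => ?_
    induction i using Fin.succAboveCases j with
    | x => simpa using continuous_fst
    | p i => simp only [Fin.insertNth_apply_succAbove]; fun_prop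
  have hc : Continuous fun x => fderiv ℝ a x (Pi.single j 1) :=
    (ha.continuous_fderiv one_ne_zero).clm_apply continuous_const
  rw [setIntegral_solidSimplex_succ j _ hc, ← setIntegral_slant j, ← integral_sub]
  · refine integral_congr_ae (Filter.Eventually.of_forall fun y => ?_)
    dsimp only
    refine intervalIntegral.integral_eq_sub_of_hasDerivAt
      (f := fun t => a (j.insertNth t y)) (fun t _ => ?_) ?_
    · exact ((ha.differentiable one_ne_zero _).hasFDerivAt).comp_hasDerivAt t (hins y t)
    · refine Continuous.intervalIntegrable ?_ _ _
      exact hc.comp (hinsc.comp (by fun_prop : Continuous fun t : ℝ => (t, y)))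
  · exact hint (ha.continuous.comp (hinsc.comp
      (by fun_prop : Continuous fun y : Fin k → ℝ => (1 - ∑ i, y i, y))))
  · exact hint (ha.continuous.comp (hinsc.comp
      (by fun_prop : Continuous fun y : Fin k → ℝ => ((0 : ℝ), y))))

/-- The bubble function of the `i`-th face in barycentric coordinates: the product of the coordinates
of the vertices of that face. -/
def faceBubble {k : ℕ} (i : Fin (k + 2)) (t : Fin (k + 2) → ℝ) : ℝ :=
  ∏ j : Fin (k + 1), t (i.succAbove j)

/-- The integral of the product of all barycentric coordinates. -/
noncomputable def bubbleMass (k : ℕ) : ℝ := ∫ y in solidSimplex k, ∏ j, bary y j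

theorem bubbleMass_pos (k : ℕ) : 0 < bubbleMass k := by
  have hc : Continuous fun y : Fin k → ℝ => ∏ j, bary y j :=
    continuous_finsetProd _ fun j _ => (continuous_apply j).comp continuous_bary
  rw [bubbleMass, ← setIntegral_congr_set (openSolidSimplex_ae_eq k)]
  rw [setIntegral_pos_iff_support_of_nonneg_ae]
  · refine lt_of_lt_of_le ((isOpen_openSolidSimplex k).measure_pos volume
      (openSolidSimplex_nonempty k)) (measure_mono fun x hx => ⟨?_, hx⟩)
    exact (Finset.prod_pos fun j _ => bary_pos hx j).ne'
  · filter_upwards [ae_restrict_mem (isOpen_openSolidSimplex k).measurableSet] with x hx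
    exact (Finset.prod_pos fun j _ => bary_pos hx j).le
  · exact (hc.continuousOn.integrableOn_compact (isCompact_solidSimplex _)).mono_set
      (openSolidSimplex_subset k)

theorem contDiff_faceBubble {k : ℕ} (i : Fin (k + 2)) : ContDiff ℝ ∞ (faceBubble i) :=
  contDiff_prod fun _ _ => contDiff_apply _ _ _

theorem baryLinear_apply_zero {k : ℕ} (w : Fin k → ℝ) : baryLinear k w 0 = -∑ j, w j := by
  have h2 := push_succAbove 0 w
  rw [Fin.insertNth_zero', Fin.succAbove_zero] at h2
  simp [baryLinear, h2]

theorem baryLinear_apply_succ {k : ℕ} (w : Fin k → ℝ) (m : Fin k) :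
    baryLinear k w m.succ = w m := by
  have h2 := push_succAbove 0 w
  rw [Fin.insertNth_zero', Fin.succAbove_zero] at h2
  simp [baryLinear, h2]

/-- The bubble of the facet `i` vanishes on every other facet and restricts on its own to the
product of all barycentric coordinates. Only that facet survives in `setIntegral_partialDeriv`. The
factor `baryLinear (k + 1) w i` is the rate of change along `w` of the barycentric coordinate
opposite to the facet; the sign is negative because that coordinate decreases outwards. -/
theorem setIntegral_fderiv_faceBubble {k : ℕ} (i : Fin (k + 2)) (w : Fin (k + 1) → ℝ) :
    ∫ x in solidSimplex (k + 1), fderiv ℝ (fun y => faceBubble i (bary y)) x w =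
      -(bubbleMass k * baryLinear (k + 1) w i) := by
  have hg : ContDiff ℝ 1 fun y : Fin (k + 1) → ℝ => faceBubble i (bary y) :=
    ((contDiff_faceBubble i).comp contDiff_bary).of_le (by norm_cast)
  have hlin : ∀ x, fderiv ℝ (fun y => faceBubble i (bary y)) x w =
      ∑ m, w m * fderiv ℝ (fun y => faceBubble i (bary y)) x (Pi.single m 1) := by
    intro x
    conv_lhs => rw [pi_eq_sum_univ' w]
    simp [map_sum]
  simp only [hlin]
  rw [integral_finsetSum]
  swap
  · intro m _
    exact (continuous_const.mul ((hg.continuous_fderiv one_ne_zero).clm_apply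
      continuous_const)).continuousOn.integrableOn_compact (isCompact_solidSimplex _)
  -- The facet `0` is the slanted one and contributes for every coordinate direction; the facet
  -- `l.succ` contributes for the direction `l` only.
  simp_rw [integral_const_mul, setIntegral_partialDeriv _ _ hg]
  refine Fin.cases ?_ (fun l => ?_) i
  · have h1 : ∀ y : Fin k → ℝ, faceBubble 0 (bary (bary y)) = ∏ j, bary y j := by
      intro y
      simp [faceBubble, bary]
    have h2 : ∀ (m : Fin (k + 1)) (y : Fin k → ℝ),
        faceBubble 0 (bary (m.insertNth (0 : ℝ) y : Fin (k + 1) → ℝ)) = 0 := by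
      intro m y
      refine Finset.prod_eq_zero (Finset.mem_univ m) ?_
      simp [bary]
    simp only [h1, h2, baryLinear_apply_zero, integral_zero, sub_zero, bubbleMass]
    rw [← Finset.sum_mul]
    ring
  · have h1 : ∀ y : Fin k → ℝ, faceBubble l.succ (bary (bary y)) = 0 := by
      intro y
      refine Finset.prod_eq_zero (Finset.mem_univ 0) ?_
      rw [Fin.succ_succAbove_zero]
      simp [bary, Fin.sum_univ_succ]
    have h2 : ∀ m : Fin (k + 1), m ≠ l → ∀ y : Fin k → ℝ,
        faceBubble l.succ (bary (m.insertNth (0 : ℝ) y : Fin (k + 1) → ℝ)) = 0 := by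
      intro m hm y
      obtain ⟨j, hj⟩ := Fin.exists_succAbove_eq (x := m.succ) (y := l.succ) (by simpa using hm)
      refine Finset.prod_eq_zero (Finset.mem_univ j) ?_
      rw [hj]
      simp [bary]
    have h3 : ∀ y : Fin k → ℝ,
        faceBubble l.succ (bary (l.insertNth (0 : ℝ) y : Fin (k + 1) → ℝ)) = ∏ j, bary y j := by
      intro y
      rw [← push_face_succ, push_succAbove]
      simp [faceBubble]
    rw [Finset.sum_eq_single l]
    · simp only [h1, h3, integral_zero, zero_sub, bubbleMass, baryLinear_apply_succ]
      ring
    · intro m _ hm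
      simp only [h1, h2 m hm, integral_zero, sub_zero, mul_zero]
    · simp

end SolidSimplex

/-! ### Determinants of a vector followed by the edges of a facet. -/

section Cramer

variable {E : Type*} [AddCommGroup E] [Module ℝ E]

/-- Cramer's rule: moving the first argument to place `j` produces the sign, and in the expansion
every term but the `j`-th repeats a vector. -/
theorem alternating_cons_sum {k : ℕ} (Ω : E [⋀^Fin (k + 1)]→ₗ[ℝ] ℝ) (v : Fin (k + 1) → E)
    (w : Fin (k + 1) → ℝ) (j : Fin (k + 1)) :
    Ω (Fin.cons (∑ m, w m • v m) fun l => v (j.succAbove l)) = (-1) ^ (j : ℕ) * (w j * Ω v) := by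
  have h1 := Ω.neg_one_pow_smul_map_insertNth j (∑ m, w m • v m) fun l => v (j.succAbove l)
  have h2 : (j.insertNth (∑ m, w m • v m) fun l => v (j.succAbove l)) =
      Function.update v j (∑ m, w m • v m) := by
    ext i : 1
    induction i using Fin.succAboveCases j with
    | x => simp
    | p i => simp [Fin.succAbove_ne]
  have h3 : Ω (Function.update v j (∑ m, w m • v m)) = w j * Ω v := by
    rw [AlternatingMap.map_update_sum, Finset.sum_eq_single j]
    · rw [AlternatingMap.map_update_smul, Function.update_eq_self, smul_eq_mul]
    · intro m _ hm
      rw [AlternatingMap.map_update_smul, AlternatingMap.map_update_self _ _ hm.symm, smul_zero]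
    · simp
  rw [h2, h3] at h1
  have h4 : (Matrix.vecCons (∑ m, w m • v m) fun l => v (j.succAbove l)) =
    Fin.cons (∑ m, w m • v m) fun l => v (j.succAbove l) := rfl
  rw [← h4, ← h1]
  simp

/-- The right side has the factor of `setIntegral_fderiv_faceBubble`, while the left side is written
with the edges of the facet alone. This allows facets of different simplices to be compared. -/
theorem alternating_cons_face {k : ℕ} (Ω : E [⋀^Fin (k + 1)]→ₗ[ℝ] ℝ) (v : Fin (k + 2) → E)
    (hv : v 0 = 0) (w : Fin (k + 1) → ℝ) (i : Fin (k + 2)) :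
    Ω (Fin.cons (∑ m, w m • v m.succ)
      fun l : Fin k => v (i.succAbove l.succ) - v (i.succAbove 0)) =
      -((-1) ^ (i : ℕ) * (baryLinear (k + 1) w i * Ω fun m => v m.succ)) := by
  refine Fin.cases ?_ (fun l => ?_) i
  -- The facet opposite to vertex `0` has its edges based at vertex `1`, so they are differences of
  -- the vectors `v m.succ`; `alternating_sub_first` expands the determinant into one term of Cramer
  -- type for each omitted vector.
  · let φ : (Fin (k + 1) → ℝ) →ₗ[ℝ] E := Fintype.linearCombination ℝ fun m => v m.succ
    have hφ : ∀ m, φ (Pi.single m 1) = v m.succ := fun m => by simp [φ]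
    have h := alternating_sub_first
      ((Ω.curryLeft (∑ m, w m • v m.succ)).compLinearMap φ)
    simp only [AlternatingMap.compLinearMap_apply, AlternatingMap.curryLeft_apply_apply, map_sub, hφ]
      at h
    have hc : ∀ j : Fin (k + 1), Ω (Matrix.vecCons (∑ m, w m • v m.succ)
        fun i => v (j.succAbove i).succ) = (-1) ^ (j : ℕ) * (w j * Ω fun m => v m.succ) :=
      fun j => alternating_cons_sum Ω (fun m => v m.succ) w j
    simp only [Fin.succAbove_zero, Fin.succ_zero_eq_one, baryLinear_apply_zero, Fin.val_zero, pow_zero, one_mul]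
    refine h.trans ?_
    simp only [hc, neg_mul, neg_neg, Finset.sum_mul]
    refine Finset.sum_congr rfl fun j _ => ?_
    rw [← mul_assoc, ← mul_pow]
    simp
  · simp only [Fin.succ_succAbove_succ, Fin.succ_succAbove_zero, hv, sub_zero,
      baryLinear_apply_succ, alternating_cons_sum Ω (fun m => v m.succ) w l]
    simp [pow_succ]

end Cramer

/-! ### Factorization of order embeddings and codimension one faces. -/

section OrderEmbeddings

noncomputable instance fintypeOrderEmbeddingFin (m n : ℕ) : Fintype (Fin m ↪o Fin n) :=
  Fintype.ofFinite _

theorem orderEmbedding_factor {k m n : ℕ} (θ : Fin k ↪o Fin n) (φ : Fin m ↪o Fin n)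
    (h : ∀ j, θ j ∈ range φ) : ∃ ψ : Fin k ↪o Fin m, ψ.trans φ = θ := by
  choose g hg using h
  refine ⟨OrderEmbedding.ofStrictMono g fun a b hab => ?_, ?_⟩
  · rw [← φ.lt_iff_lt, hg, hg]
    exact θ.strictMono hab
  · ext j : 1
    exact hg j

theorem orderEmbedding_self_eq_refl {k : ℕ} (θ : Fin k ↪o Fin k) : θ = RelEmbedding.refl _ := by
  refine OrderEmbedding.range_inj.1 ?_
  rw [(Finite.injective_iff_surjective.1 θ.injective).range_eq]
  exact (range_id).symm

/-- An embedding into a set with one more element misses a point `i`, and it factors through the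
embedding that omits `i` by an order automorphism, which is the identity. Sums over embeddings thus
become sums over the face maps. -/
theorem bijective_succAboveOrderEmb (k : ℕ) :
    Function.Bijective (Fin.succAboveOrderEmb : Fin (k + 1) → (Fin k ↪o Fin (k + 1))) := by
  refine ⟨fun i j h => ?_, fun θ => ?_⟩
  · have := congrArg (fun θ : Fin k ↪o Fin (k + 1) => range θ) h
    simpa using this
  · have hns : ¬Function.Surjective θ := fun h => by
      have := Fintype.card_le_of_surjective _ h
      simp at this
    obtain ⟨i, hi⟩ := not_forall.1 hns
    obtain ⟨ψ, hψ⟩ := orderEmbedding_factor θ (Fin.succAboveOrderEmb i) fun j => by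
      rw [Fin.range_succAboveOrderEmb]
      exact fun h => hi ⟨j, h⟩
    refine ⟨i, ?_⟩
    rw [← hψ, orderEmbedding_self_eq_refl ψ]
    rfl

end OrderEmbeddings

namespace SemiSimplicialSet

/-! ### Test functions on the geometric realization. -/

section Weight

variable {S : SemiSimplicialSet.{u}}

open Classical in
/-- The sum, over the faces of `s` that are equal to `u`, of the product of the coordinates of the
vertices of the face. -/
noncomputable def facePoly {k n : ℕ} (u : S.X k) (s : S.X n) (t : Fin (n + 1) → ℝ) : ℝ :=
  ∑ θ : Fin (k + 1) ↪o Fin (n + 1), if S.map θ s = u then ∏ j, t (θ j) else 0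

theorem push_apply_of_injective {m n : ℕ} {φ : Fin m → Fin n} (hφ : Function.Injective φ)
    (t : Fin m → ℝ) (j : Fin m) : FunOnFinite.linearMap ℝ ℝ φ t (φ j) = t j := by
  rw [FunOnFinite.linearMap_apply_apply, Finset.sum_eq_single j]
  · intro i hi hij
    exact absurd (hφ (Finset.mem_filter.1 hi).2) hij
  · intro h
    exact absurd (by simp) h

theorem push_apply_of_notMem_range {m n : ℕ} {φ : Fin m → Fin n} (t : Fin m → ℝ) {l : Fin n}
    (hl : l ∉ range φ) : FunOnFinite.linearMap ℝ ℝ φ t l = 0 := by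
  rw [FunOnFinite.linearMap_apply_apply, Finset.sum_eq_zero]
  intro i hi
  exact absurd ⟨i, (Finset.mem_filter.1 hi).2⟩ hl

/-- This compatibility with the gluing makes `faceWeight` well defined. On the face `φ`, an
embedding that does not factor through `φ` uses a vertex whose coordinate is zero, so its product
vanishes. -/
theorem facePoly_map {k m n : ℕ} (u : S.X k) (φ : Fin (m + 1) ↪o Fin (n + 1)) (s : S.X n)
    (t : Fin (m + 1) → ℝ) :
    facePoly u (S.map φ s) t = facePoly u s (FunOnFinite.linearMap ℝ ℝ φ t) := by
  refine Fintype.sum_of_injective (fun θ => θ.trans φ) (fun θ θ' h => ?_) _ _ (fun θ hθ => ?_)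
    (fun θ => ?_)
  · ext j : 1
    exact φ.injective (DFunLike.congr_fun h j)
  · have hj : ∃ j, θ j ∉ range φ := by
      by_contra! h
      exact hθ (orderEmbedding_factor θ φ h)
    obtain ⟨j, hj⟩ := hj
    have h0 : ∏ j, FunOnFinite.linearMap ℝ ℝ φ t (θ j) = 0 :=
      Finset.prod_eq_zero (Finset.mem_univ j) (push_apply_of_notMem_range t hj)
    rw [h0, ite_self]
  · rw [S.map_trans θ φ s]
    simp only [RelEmbedding.coe_trans, Function.comp_apply, push_apply_of_injective φ.injective]

theorem contDiff_facePoly {k n : ℕ} (u : S.X k) (s : S.X n) : ContDiff ℝ ∞ (facePoly u s) := by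
  refine ContDiff.sum fun θ _ => ?_
  split_ifs
  · exact contDiff_prod fun _ _ => contDiff_apply _ _ _
  · exact contDiff_const

open Classical in
theorem facePoly_self {k : ℕ} (u s : S.X k) (t : Fin (k + 1) → ℝ) :
    facePoly u s t = if s = u then ∏ j, t j else 0 := by
  rw [facePoly, Fintype.sum_eq_single (RelEmbedding.refl _)
    fun θ h => absurd (orderEmbedding_self_eq_refl θ) h, S.map_refl]
  rfl

open Classical in
theorem facePoly_succ {k : ℕ} (u : S.X k) (s : S.X (k + 1)) (t : Fin (k + 2) → ℝ) :
    facePoly u s t = ∑ i, if S.face i s = u then faceBubble i t else 0 :=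
  ((bijective_succAboveOrderEmb (k + 1)).sum_comp
    (fun θ => if S.map θ s = u then ∏ j, t (θ j) else 0)).symm

/-- The continuous function on the realization given by `facePoly u s` on each simplex `s`. -/
noncomputable def faceWeight {k : ℕ} (u : S.X k) : S.Realization → ℝ :=
  Quot.lift (fun p => facePoly u p.2.1 p.2.2) (by
    rintro _ _ ⟨φ, s, t⟩
    exact facePoly_map u φ s t)

theorem faceWeight_char {k n : ℕ} (u : S.X k) (s : S.X n) (t : stdSimplex ℝ (Fin (n + 1))) :
    faceWeight u (char s t) = facePoly u s t := rfl

theorem continuous_faceWeight {k : ℕ} (u : S.X k) : Continuous (faceWeight u) := by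
  refine continuous_iSup_dom.2 fun p => continuous_coinduced_dom.2 ?_
  exact (contDiff_facePoly u p.2).continuous.comp continuous_subtype_val

/-- The weight of `s` separates them: among simplices of the same dimension it is positive on the
interior of `s` and zero on all the others. -/
theorem disjoint_openSimplex {k : ℕ} {s s' : S.X k} (h : s ≠ s') :
    Disjoint (openSimplex s) (openSimplex s') := by
  rw [Set.disjoint_left]
  rintro _ ⟨t, ht, rfl⟩ ⟨t', ht', h'⟩
  have := congrArg (faceWeight s) h'
  rw [faceWeight_char, faceWeight_char, facePoly_self, facePoly_self, if_neg h.symm, if_pos rfl]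
    at this
  exact (Finset.prod_pos fun j _ => ht j).ne this

end Weight

end SemiSimplicialSet

/-! ### Lebesgue measure on `E` in linear coordinates. -/

section Volume

theorem map_apply_image {d : ℕ} {E : Type*} [NormedAddCommGroup E] [NormedSpace ℝ E]
    [MeasurableSpace E] [BorelSpace E] (A : (Fin d → ℝ) ≃L[ℝ] E) (S : Set (Fin d → ℝ)) :
    Measure.map A volume (A '' S) = volume S := by
  have he : MeasurableEmbedding A := A.toHomeomorph.toMeasurableEquiv.measurableEmbedding
  rw [he.map_apply, preimage_image_eq _ A.injective]

variable {d : ℕ} {E : Type*} [NormedAddCommGroup E] [InnerProductSpace ℝ E]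
  [FiniteDimensional ℝ E] [Fact (Module.finrank ℝ E = d)] [MeasurableSpace E] [BorelSpace E]
  (o : Orientation ℝ E (Fin d))

/-- Both measures are Haar measures, so they are proportional. The factor is read off on the image
of the unit cube, a parallelepiped whose volume is the absolute value of the volume form. -/
theorem volume_eq_smul_map (A : (Fin d → ℝ) ≃L[ℝ] E) :
    (volume : Measure E) =
      ENNReal.ofReal |o.volumeForm fun j => A (Pi.single j 1)| • Measure.map A volume := by
  have hH : (Measure.map A (volume : Measure (Fin d → ℝ))).IsAddHaarMeasure :=
    A.isAddHaarMeasure_map volume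
  have h := Measure.isAddLeftInvariant_eq_smul (volume : Measure E) (Measure.map A volume)
  set c := Measure.addHaarScalarFactor (volume : Measure E) (Measure.map A volume) with hc
  have hp : parallelepiped (fun j => A (Pi.single j 1)) = A '' Icc 0 1 := by
    refine image_congr fun t _ => ?_
    conv_rhs => rw [pi_eq_sum_univ' t]
    simp [map_sum]
  have h1 : (volume : Measure E) (parallelepiped fun j => A (Pi.single j 1)) = c := by
    rw [h, hp, Measure.smul_apply, map_apply_image]
    simp [Real.volume_Icc_pi, ENNReal.smul_def]
  rw [← o.measure_eq_volume, AlternatingMap.measure_parallelepiped] at h1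
  rw [h1]
  exact h

theorem volumeForm_ne_zero (A : (Fin d → ℝ) ≃L[ℝ] E) :
    (o.volumeForm fun j => A (Pi.single j 1)) ≠ 0 := by
  intro h
  have := volume_eq_smul_map o A
  rw [h, abs_zero, ENNReal.ofReal_zero, zero_smul] at this
  exact NeZero.ne (volume : Measure E) this

theorem setIntegral_image_affine (A : (Fin d → ℝ) ≃L[ℝ] E) (a : E) (S : Set (Fin d → ℝ))
    (G : E → ℝ) :
    ∫ x in (fun y => a + A y) '' S, G x =
      |o.volumeForm fun j => A (Pi.single j 1)| * ∫ y in S, G (a + A y) := by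
  have he : MeasurableEmbedding A := A.toHomeomorph.toMeasurableEquiv.measurableEmbedding
  have h1 : (fun y => a + A y) '' S = (fun x => a + x) '' (A '' S) := (image_image _ _ _).symm
  rw [h1, (measurePreserving_add_left volume a).setIntegral_image_emb
    (measurableEmbedding_addLeft a)]
  conv_lhs => rw [volume_eq_smul_map o A]
  rw [Measure.restrict_smul, integral_smul_measure, he.setIntegral_map,
    preimage_image_eq _ A.injective, ENNReal.toReal_ofReal (abs_nonneg _), smul_eq_mul]

theorem ae_eq_image_affine (A : (Fin d → ℝ) ≃L[ℝ] E) (a : E) {S T : Set (Fin d → ℝ)}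
    (h : S =ᵐ[volume] T) :
    ((fun y => a + A y) '' S : Set E) =ᵐ[volume] (fun y => a + A y) '' T := by
  -- Any orientation serves, since only the absolute value of its volume form enters.
  let o : Orientation ℝ E (Fin d) := (Module.finBasisOfFinrankEq ℝ E Fact.out).orientation
  have key : ∀ {S T : Set (Fin d → ℝ)}, S ≤ᵐ[volume] T →
      ((fun y => a + A y) '' S : Set E) ≤ᵐ[volume] (fun y => a + A y) '' T := by
    intro S T h
    rw [ae_le_set] at h ⊢
    have hinj : Function.Injective fun y => a + A y := fun x y hxy => A.injective (by simpa using hxy)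
    have h1 : (fun y => a + A y) '' (S \ T) = (fun x => a + x) '' (A '' (S \ T)) :=
      (image_image _ _ _).symm
    rw [← image_sdiff hinj, h1, image_add_left, measure_preimage_add, volume_eq_smul_map o A,
      Measure.smul_apply, map_apply_image, h, smul_zero]
  exact (key h.le).antisymm (key h.symm.le)

end Volume

namespace FBSComplex

open SemiSimplicialSet

/-! ### Tiles as affine images of the solid simplex. -/

section Tiles

theorem openTile_subset_tile {d : ℕ} {E : Type*} [NormedAddCommGroup E] [NormedSpace ℝ E]
    (B : FBSComplex.{u} d E) (s : B.X d) (a : E) : B.openTile s a ⊆ B.tile s a := by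
  rintro x ⟨t, -, h⟩
  exact ⟨t, h⟩

variable {d : ℕ} {E : Type*} [NormedAddCommGroup E] [InnerProductSpace ℝ E]
  [FiniteDimensional ℝ E] [hd : Fact (Module.finrank ℝ E = d)] (B : FBSComplex.{u} d E)

/-- The basis of `E` given by the edges of a `d`-simplex originating in its vertex `0`. -/
noncomputable def edgeBasis (s : B.X d) : Module.Basis (Fin d) ℝ E :=
  Module.Basis.mk (B.linearIndependent d s) (by
    rw [(B.linearIndependent d s).span_eq_top_of_card_eq_finrank' (by simp [hd.out])])

/-- The linear map that sends the solid simplex onto the prototile of `s`. -/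
noncomputable def frame (s : B.X d) : (Fin d → ℝ) ≃L[ℝ] E :=
  (B.edgeBasis s).equivFun.symm.toContinuousLinearEquiv

theorem frame_apply (s : B.X d) (x : Fin d → ℝ) :
    B.frame s x = ∑ j, x j • edgeVec B.rho s j.succ := by
  simp [frame, edgeBasis, Module.Basis.equivFun_symm_apply]

theorem frame_single (s : B.X d) (j : Fin d) :
    B.frame s (Pi.single j 1) = edgeVec B.rho s j.succ := by
  rw [frame_apply, Finset.sum_eq_single j]
  · simp
  · intro i _ hi
    simp [hi]
  · simp

theorem shape_eq_frame (s : B.X d) (t : stdSimplex ℝ (Fin (d + 1))) :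
    B.shape s t = B.frame s fun j => t j.succ := by
  rw [shape, Fin.sum_univ_succ, frame_apply]
  simp [edgeVec]

theorem bary_tail {k : ℕ} (t : stdSimplex ℝ (Fin (k + 1))) : bary (fun j => t j.succ) = t := by
  have h := stdSimplex.sum_eq_one t
  rw [Fin.sum_univ_succ] at h
  ext i
  refine Fin.cases ?_ (fun m => ?_) i
  · simp only [bary, Fin.cons_zero]; linarith
  · simp [bary]

theorem shape_bary (s : B.X d) {x : Fin d → ℝ} (hx : x ∈ solidSimplex d) :
    B.shape s ⟨bary x, bary_mem hx⟩ = B.frame s x := by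
  rw [shape_eq_frame]
  congr 1

theorem tile_eq_image (s : B.X d) (a : E) :
    B.tile s a = (fun x => a + B.frame s x) '' solidSimplex d := by
  ext y
  constructor
  · rintro ⟨t, rfl⟩
    refine ⟨fun j => t j.succ, ⟨fun j => t.2.1 _, ?_⟩, by rw [shape_eq_frame]⟩
    have h := stdSimplex.sum_eq_one t
    rw [Fin.sum_univ_succ] at h
    have := t.2.1 0
    change 0 ≤ t 0 at this
    linarith
  · rintro ⟨x, hx, rfl⟩
    exact ⟨⟨bary x, bary_mem hx⟩, by rw [shape_bary _ _ hx]⟩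

theorem openTile_eq_image (s : B.X d) (a : E) :
    B.openTile s a = (fun x => a + B.frame s x) '' openSolidSimplex d := by
  ext y
  constructor
  · rintro ⟨t, ht, rfl⟩
    refine ⟨fun j => t j.succ, ⟨fun j => ht _, ?_⟩, by rw [shape_eq_frame]⟩
    have h := stdSimplex.sum_eq_one t
    rw [Fin.sum_univ_succ] at h
    have := ht 0
    linarith
  · rintro ⟨x, hx, rfl⟩
    exact ⟨⟨bary x, bary_mem (openSolidSimplex_subset d hx)⟩, bary_pos hx, by
      rw [shape_bary _ _ (openSolidSimplex_subset d hx)]⟩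

/-- The affine homeomorphism that sends the solid simplex onto the tile of `s` at `a`. -/
noncomputable def frameHomeomorph (s : B.X d) (a : E) : (Fin d → ℝ) ≃ₜ E :=
  (B.frame s).toHomeomorph.trans (Homeomorph.addLeft a)

theorem isOpen_openTile (s : B.X d) (a : E) : IsOpen (B.openTile s a) := by
  rw [openTile_eq_image]
  exact (B.frameHomeomorph s a).isOpenMap _ (isOpen_openSolidSimplex d)

theorem isCompact_tile (s : B.X d) (a : E) : IsCompact (B.tile s a) := by
  rw [tile_eq_image]
  exact (isCompact_solidSimplex d).image (B.frameHomeomorph s a).continuous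

theorem tile_subset_closure (s : B.X d) (a : E) : B.tile s a ⊆ closure (B.openTile s a) := by
  rw [tile_eq_image, openTile_eq_image]
  exact (image_mono (solidSimplex_subset_closure d)).trans
    (image_closure_subset_closure_image (B.frameHomeomorph s a).continuous)

/-- A common bound for the diameters of the tiles. -/
theorem exists_diam_bound : ∃ D : ℝ, 0 ≤ D ∧
    ∀ (s : B.X d) (a : E), ∀ x ∈ B.tile s a, ∀ y ∈ B.tile s a, dist x y ≤ D := by
  have := B.finite d
  choose C hC using fun s : B.X d => (Metric.isBounded_iff.1 (B.isCompact_tile s 0).isBounded)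
  obtain ⟨D, hD⟩ := (finite_range C).bddAbove
  refine ⟨max D 0, le_max_right _ _, fun s a x hx y hy => ?_⟩
  rw [tile_eq_image] at hx hy
  obtain ⟨x, hx, rfl⟩ := hx
  obtain ⟨y, hy, rfl⟩ := hy
  have h := hC s (x := B.frame s x) (by rw [tile_eq_image]; exact ⟨x, hx, by simp⟩)
    (y := B.frame s y) (by rw [tile_eq_image]; exact ⟨y, hy, by simp⟩)
  rw [dist_add_left]
  exact h.trans ((hD ⟨s, rfl⟩).trans (le_max_left _ _))

variable (o : Orientation ℝ E (Fin d))

/-- The value of the volume form on the edges of `s` originating in its vertex `0`. -/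
noncomputable def edgeVolume (s : B.X d) : ℝ :=
  o.volumeForm fun j : Fin d => edgeVec B.rho s j.succ

theorem edgeVolume_ne_zero (s : B.X d) : B.edgeVolume o s ≠ 0 := by
  borelize E
  have := volumeForm_ne_zero o (B.frame s)
  simp only [frame_single] at this
  exact this

variable [MeasurableSpace E] [BorelSpace E]

theorem setIntegral_openTile (s : B.X d) (a : E) (G : E → ℝ) :
    ∫ x in B.openTile s a, G x =
      |B.edgeVolume o s| * ∫ y in solidSimplex d, G (a + B.frame s y) := by
  rw [openTile_eq_image, setIntegral_image_affine o, setIntegral_congr_set (openSolidSimplex_ae_eq d)]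
  simp only [frame_single, edgeVolume]

theorem openTile_ae_eq (s : B.X d) (a : E) : B.openTile s a =ᵐ[volume] B.tile s a := by
  rw [openTile_eq_image, tile_eq_image]
  exact ae_eq_image_affine _ a (openSolidSimplex_ae_eq d)

theorem volume_openTile (s : B.X d) (a : E) :
    volume.real (B.openTile s a) = |B.edgeVolume o s| * volume.real (solidSimplex d) := by
  have := B.setIntegral_openTile o s a fun _ => 1
  simpa using this

end Tiles

end FBSComplex

/-! ### Lipschitz functions and their averages over large balls. -/

section Analysis

/-- A continuous function that is `K`-Lipschitz on each set of a closed cover which is locally finite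
is `K`-Lipschitz. -/
theorem lipschitzWith_of_closed_cover {E : Type*} [NormedAddCommGroup E] [NormedSpace ℝ E]
    {F : E → ℝ} (hF : Continuous F) {ι : Type*} {T : ι → Set E} (hT : ∀ i, IsClosed (T i))
    {K : NNReal} (hK : ∀ i, LipschitzOnWith K F (T i))
    (hc : ∀ x, ∃ I : Set ι, I.Finite ∧ ∀ᶠ y in nhds x, ∃ i ∈ I, y ∈ T i) : LipschitzWith K F := by
  refine LipschitzWith.of_le_add_mul K fun y x => ?_
  let p : ℝ → E := fun τ => x + τ • (y - x)
  have hp : Continuous p := by fun_prop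
  have hdist : ∀ z τ, dist (p z) (p τ) = |z - τ| * dist y x := by
    intro z τ
    have h : p z - p τ = (z - τ) • (y - x) := by simp only [p, sub_smul]; abel
    rw [dist_eq_norm, h, norm_smul, Real.norm_eq_abs, dist_eq_norm]
  -- This form of the mean value inequality on the segment from `x` to `y` needs the slope bound
  -- only for points arbitrarily close on the right of each `τ`.
  have key := image_le_of_liminf_slope_right_le_deriv_boundary (f := F ∘ p) (a := 0) (b := 1)
    (B := fun τ => F x + K * dist y x * τ) (B' := fun _ => K * dist y x)
    (hF.comp hp).continuousOn (by simp [p]) (by fun_prop)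
    (fun τ _ => by
      simpa using (((hasDerivAt_id τ).const_mul (K * dist y x)).const_add (F x)).hasDerivWithinAt)
    (fun τ _ r hr => by
      obtain ⟨I, hI, hIx⟩ := hc (p τ)
      have h1 : ∀ᶠ z in nhdsWithin τ (Ioi τ), ∃ i ∈ I, p z ∈ T i :=
        (hp.tendsto τ |>.eventually hIx).filter_mono nhdsWithin_le_nhds
      -- By finiteness, one piece contains points of the segment arbitrarily close on the right of
      -- `τ`; being closed, it also contains `p τ`, and its Lipschitz bound applies to the slopes.
      have h2 : ∃ i ∈ I, ∃ᶠ z in nhdsWithin τ (Ioi τ), p z ∈ T i := by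
        by_contra! h
        have := (Filter.eventually_all_finite hI).2 h
        obtain ⟨z, ⟨i, hi, hz⟩, hz'⟩ := (h1.and this).exists
        exact hz' i hi hz
      obtain ⟨i, -, hi⟩ := h2
      have hτ : p τ ∈ T i := (hT i).mem_of_frequently_of_tendsto hi
        ((hp.tendsto τ).mono_left nhdsWithin_le_nhds)
      refine (hi.and_eventually self_mem_nhdsWithin).mono fun z hz => ?_
      obtain ⟨hz, hlt⟩ := hz
      have hlt : 0 < z - τ := sub_pos.2 hlt
      refine lt_of_le_of_lt ?_ hr
      rw [slope_def_field, div_le_iff₀ hlt]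
      have h3 := (hK i).dist_le_mul _ hz _ hτ
      rw [hdist, abs_of_pos hlt, Real.dist_eq] at h3
      exact (le_abs_self _).trans (h3.trans_eq (by ring)))
  have := key (right_mem_Icc.2 zero_le_one)
  simpa [p] using this

variable {E : Type*} [NormedAddCommGroup E] [NormedSpace ℝ E] [FiniteDimensional ℝ E]
  [MeasurableSpace E] (μ : Measure E) [μ.IsAddHaarMeasure]

theorem measureReal_ball_pos {r : ℝ} (hr : 0 < r) : 0 < μ.real (Metric.ball (0 : E) r) :=
  ENNReal.toReal_pos (Metric.measure_ball_pos μ 0 hr).ne' measure_ball_lt_top.ne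

variable [BorelSpace E]

theorem tendsto_measureReal_ball_add_div (c : ℝ) :
    Filter.Tendsto (fun r : ℕ => μ.real (Metric.ball (0 : E) (r + c)) / μ.real (Metric.ball 0 r))
      Filter.atTop (nhds 1) := by
  have h1 : Filter.Tendsto (fun r : ℕ => (((r : ℝ) + c) / r) ^ Module.finrank ℝ E) Filter.atTop
      (nhds 1) := by
    have h0 : Filter.Tendsto (fun r : ℕ => 1 + c / (r : ℝ)) Filter.atTop (nhds (1 + 0)) :=
      tendsto_const_nhds.add (tendsto_const_div_atTop_nhds_zero_nat c)
    rw [add_zero] at h0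
    have h := h0.pow (Module.finrank ℝ E)
    rw [one_pow] at h
    refine h.congr' ?_
    filter_upwards [Filter.eventually_gt_atTop 0] with r hr
    have : (r : ℝ) ≠ 0 := by positivity
    rw [add_div, div_self this]
  refine h1.congr' ?_
  have h2 : ∀ {ρ : ℝ}, 0 < ρ → μ.real (Metric.ball (0 : E) ρ) =
      ρ ^ Module.finrank ℝ E * μ.real (Metric.ball 0 1) := by
    intro ρ hρ
    rw [measureReal_def, Measure.addHaar_ball_of_pos μ 0 hρ, ENNReal.toReal_mul,
      ENNReal.toReal_ofReal (by positivity), measureReal_def]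
  filter_upwards [Filter.eventually_gt_atTop 0,
    tendsto_natCast_atTop_atTop.eventually_gt_atTop (-c)] with r hr hrc
  have hr : (0 : ℝ) < r := by positivity
  rw [h2 hr, h2 (by linarith), mul_div_mul_right _ _ (measureReal_ball_pos μ one_pos).ne', div_pow]

theorem tendsto_measureReal_shell_div (b c : ℝ) (hbc : b ≤ c) :
    Filter.Tendsto (fun r : ℕ => μ.real (Metric.ball (0 : E) (r + c) \ Metric.ball 0 (r + b)) /
      μ.real (Metric.ball 0 r)) Filter.atTop (nhds 0) := by
  have h := (tendsto_measureReal_ball_add_div μ c).sub (tendsto_measureReal_ball_add_div μ b)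
  rw [sub_self] at h
  refine h.congr fun r => ?_
  rw [measureReal_sdiff (Metric.ball_subset_ball (by linarith)) measurableSet_ball
    measure_ball_lt_top.ne, sub_div]

/-- Integration by parts against a cutoff of the ball moves the derivative to the cutoff. Both the
resulting integral and the error made by the cutoff live in a shell of bounded width, which is
negligible against the volume of the ball. -/
theorem tendsto_average_lineDeriv {F : E → ℝ} {K : NNReal} (hK : LipschitzWith K F) {C : ℝ}
    (hC : ∀ x, |F x| ≤ C) (n : E) :
    Filter.Tendsto (fun r : ℕ => (∫ x in Metric.ball (0 : E) r, lineDeriv ℝ F x n ∂μ) /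
      μ.real (Metric.ball (0 : E) r)) Filter.atTop (nhds 0) := by
  have hbound : ∀ x, |lineDeriv ℝ F x n| ≤ K * ‖n‖ := fun x =>
    norm_lineDeriv_le_of_lipschitz ℝ hK
  have hmeas : Measurable fun x => lineDeriv ℝ F x n := measurable_lineDeriv hK.continuous
  have hC0 : 0 ≤ C := (abs_nonneg _).trans (hC 0)
  have main : ∀ r : ℕ, |∫ x in Metric.ball (0 : E) r, lineDeriv ℝ F x n ∂μ| ≤
      (K * ‖n‖ + C * ‖n‖) * μ.real (Metric.ball (0 : E) (r + 1) \ Metric.ball 0 (r + -1)) := by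
    intro r
    set A : Set E := Metric.ball (0 : E) (r + 1) \ Metric.ball 0 (r + -1) with hA
    have hAm : MeasurableSet A := measurableSet_ball.diff measurableSet_ball
    have hAfin : μ A ≠ ⊤ := ((measure_mono sdiff_subset).trans_lt measure_ball_lt_top).ne
    -- The cutoff is `1` up to radius `r - 1`, `0` from radius `r` on, and `1`-Lipschitz. The outer
    -- radius `r + 1` of the shell `A` leaves room for the cutoff to be locally constant at every
    -- point outside `A`.
    let g : E → ℝ := fun x => max 0 (min 1 (r - ‖x‖))
    have hg : LipschitzWith 1 g := by
      have : LipschitzWith 1 fun x : E => (r : ℝ) - ‖x‖ := by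
        refine LipschitzWith.of_dist_le_mul fun x y => ?_
        rw [NNReal.coe_one, one_mul, Real.dist_eq, dist_eq_norm, sub_sub_sub_cancel_left, abs_sub_comm]
        exact abs_norm_sub_norm_le x y
      exact (this.const_min 1).const_max 0
    have hg0 : ∀ x, (r : ℝ) ≤ ‖x‖ → g x = 0 := fun x hx =>
      max_eq_left ((min_le_right _ _).trans (by linarith))
    have hg1 : ∀ x, ‖x‖ ≤ r - 1 → g x = 1 := fun x hx => by
      simp only [g]
      rw [min_eq_left (by linarith), max_eq_right zero_le_one]
    have hg01 : ∀ x, 0 ≤ g x ∧ g x ≤ 1 := fun x =>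
      ⟨le_max_left _ _, max_le zero_le_one (min_le_left _ _)⟩
    have hgs : HasCompactSupport g := by
      refine HasCompactSupport.intro (isCompact_closedBall (0 : E) r) fun x hx => hg0 x ?_
      simp only [mem_closedBall_zero_iff, not_le] at hx
      exact hx.le
    have hparts := hK.integral_lineDeriv_mul_eq (μ := μ) hg hgs n
    have hdg : ∀ x, |lineDeriv ℝ g x (-n) * F x| ≤ A.indicator (fun _ => C * ‖n‖) x := by
      intro x
      by_cases hx : x ∈ A
      · rw [indicator_of_mem hx, abs_mul, mul_comm]
        have h1 : |lineDeriv ℝ g x (-n)| ≤ ‖n‖ := by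
          simpa using (norm_lineDeriv_le_of_lipschitz ℝ hg : ‖lineDeriv ℝ g x (-n)‖ ≤ _)
        exact mul_le_mul (hC x) h1 (abs_nonneg _) hC0
      · have h0 : lineDeriv ℝ g x (-n) = 0 := by
          have hloc : ∃ c : ℝ, g =ᶠ[nhds x] fun _ => c := by
            simp only [hA, mem_sdiff, mem_ball_zero_iff, not_and, not_not] at hx
            by_cases hx1 : ‖x‖ < r + 1
            · refine ⟨1, ?_⟩
              filter_upwards [continuous_norm.continuousAt.eventually_lt continuousAt_const (hx hx1)]
                with y hy
              exact hg1 y (by linarith)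
            · refine ⟨0, ?_⟩
              filter_upwards [continuousAt_const.eventually_lt continuous_norm.continuousAt
                (show (r : ℝ) < ‖x‖ by linarith)] with y hy
              exact hg0 y hy.le
          obtain ⟨c, hc⟩ := hloc
          rw [hc.lineDeriv_eq]
          simp [lineDeriv]
        rw [h0, zero_mul, abs_zero, indicator_of_notMem hx]
    have hrest : ∀ x, |(Metric.ball (0 : E) r).indicator (fun x => lineDeriv ℝ F x n) x -
        lineDeriv ℝ F x n * g x| ≤ A.indicator (fun _ => K * ‖n‖) x := by
      intro x
      by_cases hxr : ‖x‖ < r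
      · rw [indicator_of_mem (by simpa using hxr)]
        by_cases hx : x ∈ A
        · rw [indicator_of_mem hx, ← mul_one_sub, abs_mul, abs_of_nonneg (sub_nonneg.2 (hg01 x).2)]
          exact (mul_le_of_le_one_right (abs_nonneg _) (sub_le_self _ (hg01 x).1)).trans (hbound x)
        · rw [indicator_of_notMem hx]
          simp only [hA, mem_sdiff, mem_ball_zero_iff, not_and, not_not] at hx
          rw [hg1 x (by linarith [hx (by linarith)])]
          simp
      · rw [indicator_of_notMem (by simpa using hxr), hg0 x (not_lt.1 hxr)]
        simp only [mul_zero, sub_zero, abs_zero]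
        exact indicator_nonneg (fun _ _ => by positivity) x
    have hi1 : Integrable ((Metric.ball (0 : E) r).indicator fun x => lineDeriv ℝ F x n) μ := by
      rw [integrable_indicator_iff measurableSet_ball]
      exact Measure.integrableOn_of_bounded (M := K * ‖n‖) measure_ball_lt_top.ne
        hmeas.aestronglyMeasurable (Filter.Eventually.of_forall hbound)
    have hi2 : Integrable (fun x => lineDeriv ℝ F x n * g x) μ :=
      (hg.continuous.integrable_of_hasCompactSupport hgs).bdd_mul hmeas.aestronglyMeasurable
        (Filter.Eventually.of_forall hbound)
    have hiA : ∀ c : ℝ, Integrable (A.indicator fun _ => c) μ := fun c =>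
      (integrable_indicator_iff hAm).2 (integrableOn_const hAfin)
    have hA' : ∀ c : ℝ, ∫ x, A.indicator (fun _ => c) x ∂μ = c * μ.real A := fun c => by
      rw [integral_indicator hAm, setIntegral_const, smul_eq_mul, mul_comm]
    have e1 : ∫ x in Metric.ball (0 : E) r, lineDeriv ℝ F x n ∂μ =
        (∫ x, ((Metric.ball (0 : E) r).indicator (fun x => lineDeriv ℝ F x n) x -
          lineDeriv ℝ F x n * g x) ∂μ) + ∫ x, lineDeriv ℝ g x (-n) * F x ∂μ := by
      rw [integral_sub hi1 hi2, integral_indicator measurableSet_ball, hparts]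
      ring
    rw [e1, add_mul, ← hA' (K * ‖n‖), ← hA' (C * ‖n‖)]
    refine (abs_add_le _ _).trans (add_le_add ?_ ?_)
    · exact norm_integral_le_of_norm_le (hiA _) (Filter.Eventually.of_forall fun x =>
        (Real.norm_eq_abs _).trans_le (hrest x))
    · exact norm_integral_le_of_norm_le (hiA _) (Filter.Eventually.of_forall fun x =>
        (Real.norm_eq_abs _).trans_le (hdg x))
  have hshell := (tendsto_measureReal_shell_div μ (-1) 1 (by norm_num)).const_mul
    (K * ‖n‖ + C * ‖n‖)
  rw [mul_zero] at hshell
  refine squeeze_zero_norm (fun r => ?_) hshell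
  rw [Real.norm_eq_abs, abs_div, abs_of_nonneg (measureReal_nonneg (μ := μ)), ← mul_div_assoc]
  exact div_le_div_of_nonneg_right (main r) measureReal_nonneg

end Analysis

namespace FBSComplex

open SemiSimplicialSet

namespace IsometricWinding

/-! ### Patches of tiles in a ball. -/

section Basic

variable {d : ℕ} {E : Type*} [NormedAddCommGroup E] [NormedSpace ℝ E] {B : FBSComplex.{u} d E}
  (f : B.IsometricWinding)

theorem disjoint_openTile {s s' : B.X d} {a a' : E} (ha : a ∈ f.pos s) (ha' : a' ∈ f.pos s')
    (h : s ≠ s') : Disjoint (B.openTile s a) (B.openTile s' a') := by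
  refine ((disjoint_openSimplex h).preimage f.toFun).mono ?_ ?_
  · rw [f.preimage]
    exact subset_biUnion_of_mem (u := fun a => B.openTile s a) ha
  · rw [f.preimage]
    exact subset_biUnion_of_mem (u := fun a => B.openTile s' a) ha'

/-- The positions of the tiles of `s` that are contained in the open ball of radius `r`. -/
def patch (s : B.X d) (r : ℝ) : Set E := {a ∈ f.pos s | B.tile s a ⊆ Metric.ball 0 r}

/-- The union of the interiors of the tiles contained in the open ball of radius `r`. -/
def patchUnion (r : ℝ) : Set E := ⋃ s, ⋃ a ∈ f.patch s r, B.openTile s a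

theorem patchUnion_subset (r : ℝ) : f.patchUnion r ⊆ Metric.ball 0 r :=
  iUnion_subset fun s => iUnion₂_subset fun a ha => (B.openTile_subset_tile s a).trans ha.2

theorem exists_mem_tile (x : E) : ∃ s, ∃ a ∈ f.pos s, x ∈ B.tile s a := by
  have h : x ∈ ⋃ s, ⋃ a ∈ f.pos s, B.tile s a := f.cover ▸ mem_univ x
  simpa only [mem_iUnion, exists_prop] using h

end Basic

variable {d : ℕ} {E : Type*} [NormedAddCommGroup E] [InnerProductSpace ℝ E]
  [FiniteDimensional ℝ E] [hd : Fact (Module.finrank ℝ E = d)] {B : FBSComplex.{u} d E}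
  (f : B.IsometricWinding)

theorem isOpen_patchUnion (r : ℝ) : IsOpen (f.patchUnion r) :=
  isOpen_iUnion fun s => isOpen_biUnion fun a _ => B.isOpen_openTile s a

/-- Disjoint open tiles of one common positive volume lie in a ball of finite volume. -/
theorem finite_patch (s : B.X d) (r : ℝ) : (f.patch s r).Finite := by
  borelize E
  let o : Orientation ℝ E (Fin d) := (Module.finBasisOfFinrankEq ℝ E Fact.out).orientation
  let ε := ENNReal.ofReal (|B.edgeVolume o s| * volume.real (solidSimplex d))
  have hε : 0 < ε := ENNReal.ofReal_pos.2
    (mul_pos (abs_pos.2 (B.edgeVolume_ne_zero o s)) (volume_solidSimplex_pos d))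
  have hfin : ∀ a ∈ f.patch s r, volume (B.openTile s a) ≠ ⊤ := fun a _ =>
    ((measure_mono (B.openTile_subset_tile s a)).trans_lt (B.isCompact_tile s a).measure_lt_top).ne
  have h := Measure.finite_const_le_meas_of_disjoint_iUnion (volume : Measure E) hε
    (As := fun a : f.patch s r => B.openTile s a)
    (fun a => (B.isOpen_openTile s a).measurableSet)
    (fun a b hab => f.disjoint s a.2.1 b.2.1 (fun h => hab (Subtype.ext h)))
    ((measure_mono (iUnion_subset fun a : f.patch s r => (B.openTile_subset_tile s a).trans a.2.2)).trans_lt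
      (measure_ball_lt_top (x := (0 : E)) (r := r))).ne
  have hall : {a : f.patch s r | ε ≤ volume (B.openTile s a)} = univ := by
    refine eq_univ_of_forall fun a => ?_
    have := B.volume_openTile o s a
    change ENNReal.ofReal _ ≤ _
    rw [← this, ofReal_measureReal (hfin a a.2)]
  rw [hall] at h
  exact finite_coe_iff.1 (finite_univ_iff.1 h)

/-- With `D` a bound for the diameters of all tiles, a tile that meets the ball of radius `r - D` is
contained in the ball of radius `r`. -/
theorem exists_ball_subset_patch : ∃ D : ℝ, 0 ≤ D ∧ ∀ r : ℝ,
    Metric.ball (0 : E) (r - D) ⊆ ⋃ s, ⋃ a ∈ f.patch s r, B.tile s a := by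
  obtain ⟨D, hD0, hD⟩ := B.exists_diam_bound
  refine ⟨D, hD0, fun r x hx => ?_⟩
  obtain ⟨s, a, ha, hxa⟩ := f.exists_mem_tile x
  simp only [mem_iUnion, exists_prop]
  refine ⟨s, a, ⟨ha, fun y hy => ?_⟩, hxa⟩
  have h1 := hD s a y hy x hxa
  have h2 := dist_triangle y x 0
  rw [Metric.mem_ball] at hx ⊢
  linarith

/-! ### Pull-backs to `E` of piecewise smooth functions on `|B|`. -/

section Lipschitz

/-- The function `p` of the barycentric coordinates of a prototile, as a function on `E`. -/
noncomputable def localForm (B : FBSComplex.{u} d E) (p : B.X d → (Fin (d + 1) → ℝ) → ℝ) (s : B.X d)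
    (x : E) : ℝ :=
  p s (bary ((B.frame s).symm x))

theorem contDiff_localForm {p : B.X d → (Fin (d + 1) → ℝ) → ℝ} (hp : ∀ s, ContDiff ℝ ∞ (p s))
    (s : B.X d) : ContDiff ℝ ∞ (localForm B p s) :=
  (hp s).comp (contDiff_bary.comp (B.frame s).symm.contDiff)

theorem comp_eq_localForm_openTile {w : B.S.Realization → ℝ} {p : B.X d → (Fin (d + 1) → ℝ) → ℝ}
    (hwp : ∀ s t, w (char s t) = p s t) {s : B.X d} {a : E} (ha : a ∈ f.pos s) {x : E}
    (hx : x ∈ B.openTile s a) : w (f.toFun x) = localForm B p s (x - a) := by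
  obtain ⟨t, ht, rfl⟩ := hx
  rw [f.translated s a ha t ht, hwp, localForm, shape_eq_frame, add_sub_cancel_left,
    ContinuousLinearEquiv.symm_apply_apply, bary_tail]

/-- The winding is prescribed on open tiles only; continuity extends the formula to their closures.
-/
theorem comp_eq_localForm_tile {w : B.S.Realization → ℝ} (hw : Continuous w)
    {p : B.X d → (Fin (d + 1) → ℝ) → ℝ} (hp : ∀ s, ContDiff ℝ ∞ (p s))
    (hwp : ∀ s t, w (char s t) = p s t) {s : B.X d} {a : E} (ha : a ∈ f.pos s) {x : E}
    (hx : x ∈ B.tile s a) : w (f.toFun x) = localForm B p s (x - a) := by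
  have h : EqOn (w ∘ f.toFun) (fun x => localForm B p s (x - a)) (B.openTile s a) :=
    fun x hx => f.comp_eq_localForm_openTile hwp ha hx
  exact h.closure (hw.comp f.continuous) ((contDiff_localForm hp s).continuous.comp (by fun_prop))
    (B.tile_subset_closure s a hx)

/-- On each prototile, which is compact and convex, the function is smooth, and there are finitely
many prototiles, so the constants are uniform over all tiles. Continuity and local finiteness of the
tiling make the Lipschitz bound global, without any knowledge of how tiles meet. -/
theorem exists_lipschitz_bounded {w : B.S.Realization → ℝ} (hw : Continuous w)
    {p : B.X d → (Fin (d + 1) → ℝ) → ℝ} (hp : ∀ s, ContDiff ℝ ∞ (p s))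
    (hwp : ∀ s t, w (char s t) = p s t) :
    (∃ K, LipschitzWith K (w ∘ f.toFun)) ∧ ∃ C, ∀ x, |(w ∘ f.toFun) x| ≤ C := by
  have := B.finite d
  have hsub : ∀ {s : B.X d} {a x : E}, x ∈ B.tile s a → x - a ∈ B.tile s 0 := by
    rintro s a x ⟨t, rfl⟩
    exact ⟨t, by abel⟩
  constructor
  · have hconv : ∀ s, Convex ℝ (B.tile s 0) := fun s => by
      have : B.tile s 0 = (B.frame s).toLinearEquiv.toLinearMap '' solidSimplex d := by
        rw [tile_eq_image]
        exact image_congr fun x _ => zero_add _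
      rw [this]
      exact (convex_solidSimplex d).linear_image _
    choose K hK using fun s => (contDiff_localForm hp s).contDiffOn.exists_lipschitzOnWith
      (by simp) (hconv s) (B.isCompact_tile s 0)
    obtain ⟨K', hK'⟩ := (finite_range K).bddAbove
    refine ⟨K', lipschitzWith_of_closed_cover (ι := Σ s, f.pos s) (T := fun i => B.tile i.1 i.2)
      (hw.comp f.continuous) (fun i => (B.isCompact_tile _ _).isClosed) ?_ fun x => ?_⟩
    · rintro ⟨s, a, ha⟩
      refine LipschitzOnWith.of_dist_le_mul fun x hx y hy => ?_
      simp only [Function.comp_apply, f.comp_eq_localForm_tile hw hp hwp ha hx,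
        f.comp_eq_localForm_tile hw hp hwp ha hy]
      refine ((hK s).dist_le_mul _ (hsub hx) _ (hsub hy)).trans ?_
      rw [dist_sub_right]
      exact mul_le_mul_of_nonneg_right (NNReal.coe_le_coe.2 (hK' ⟨s, rfl⟩)) dist_nonneg
    · obtain ⟨D, -, hD⟩ := f.exists_ball_subset_patch
      -- With this radius, `x` is interior to the ball of radius `r - D`, which the finitely many
      -- tiles of the patch cover.
      let r := ‖x‖ + 1 + D
      refine ⟨⋃ s, Sigma.mk s '' ((↑) ⁻¹' f.patch s r), ?_, ?_⟩
      · exact finite_iUnion fun s =>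
          ((f.finite_patch s r).preimage Subtype.val_injective.injOn).image _
      · have hx : x ∈ Metric.ball (0 : E) (r - D) := by simp [r]
        filter_upwards [Metric.isOpen_ball.mem_nhds hx] with y hy
        have := hD r hy
        simp only [mem_iUnion, exists_prop] at this
        obtain ⟨s, a, ha, hya⟩ := this
        exact ⟨⟨s, a, ha.1⟩, mem_iUnion.2 ⟨s, ⟨a, ha.1⟩, ha, rfl⟩, hya⟩
  · choose C hC using fun s => (B.isCompact_tile s 0).exists_bound_of_continuousOn
      (contDiff_localForm hp s).continuous.continuousOn
    obtain ⟨C', hC'⟩ := (finite_range C).bddAbove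
    refine ⟨C', fun x => ?_⟩
    obtain ⟨s, a, ha, hx⟩ := f.exists_mem_tile x
    rw [Function.comp_apply, f.comp_eq_localForm_tile hw hp hwp ha hx]
    exact (hC s _ (hsub hx)).trans (hC' ⟨s, rfl⟩)

end Lipschitz

/-! ### From averages over balls to sums over tiles. -/

section Averages

variable [MeasurableSpace E] [BorelSpace E]

/-- Closed tiles cover the smaller ball, and replacing each by its interior costs a null set. -/
theorem ball_ae_le_patchUnion : ∃ D : ℝ, 0 ≤ D ∧ ∀ r : ℝ,
    (Metric.ball (0 : E) (r - D) : Set E) ≤ᵐ[volume] f.patchUnion r := by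
  have := B.finite d
  obtain ⟨D, hD0, hD⟩ := f.exists_ball_subset_patch
  refine ⟨D, hD0, fun r => (LE.le.eventuallyLE (hD r)).trans ?_⟩
  refine Filter.EventuallyLE.countable_iUnion fun s => ?_
  exact Filter.EventuallyLE.countable_bUnion (f.finite_patch s r).countable
    fun a _ => (B.openTile_ae_eq s a).symm.le

theorem setIntegral_patchUnion {G : E → ℝ} {γ : B.X d → ℝ} [Fintype (B.X d)]
    (hγ : ∀ s, ∀ a ∈ f.pos s, ∫ x in B.openTile s a, G x = γ s) (r : ℝ)
    (hG : IntegrableOn G (Metric.ball 0 r)) :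
    ∫ x in f.patchUnion r, G x = ∑ s, ((f.patch s r).ncard : ℝ) * γ s := by
  have hU : ∀ s, (⋃ a ∈ f.patch s r, B.openTile s a) =
      ⋃ a ∈ (f.finite_patch s r).toFinset, B.openTile s a := fun s => by simp
  have hsub : ∀ s, (⋃ a ∈ f.patch s r, B.openTile s a) ⊆ Metric.ball 0 r := fun s =>
    (subset_iUnion (fun s => ⋃ a ∈ f.patch s r, B.openTile s a) s).trans (f.patchUnion_subset r)
  rw [patchUnion, integral_iUnion_fintype]
  · refine Finset.sum_congr rfl fun s _ => ?_
    rw [hU, integral_biUnion_finset]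
    · rw [Finset.sum_congr rfl fun a ha => hγ s a ((f.finite_patch s r).mem_toFinset.1 ha).1,
        Finset.sum_const, nsmul_eq_mul, ncard_eq_toFinset_card _ (f.finite_patch s r)]
    · exact fun a _ => (B.isOpen_openTile s a).measurableSet
    · intro a ha b hb hab
      exact f.disjoint s ((f.finite_patch s r).mem_toFinset.1 ha).1
        ((f.finite_patch s r).mem_toFinset.1 hb).1 hab
    · intro a ha
      exact hG.mono_set ((B.openTile_subset_tile s a).trans
        ((f.finite_patch s r).mem_toFinset.1 ha).2)
  · exact fun s => (isOpen_biUnion fun a _ => B.isOpen_openTile s a).measurableSet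
  · intro s s' hs
    simp only [Function.onFun, disjoint_iUnion_left, disjoint_iUnion_right]
    exact fun a ha a' ha' => f.disjoint_openTile ha'.1 ha.1 hs
  · exact fun s => hG.mono_set (hsub s)

/-- The transfer principle, applied to `G = 1` for volumes and to a directional derivative for
boundaries: the ball and the patch differ, up to a null set, by part of a shell of width `D`, where
a bounded `G` contributes negligibly. -/
theorem tendsto_sum_patch {G : E → ℝ} (hG : Measurable G) {C : ℝ} (hC : ∀ x, |G x| ≤ C)
    {γ : B.X d → ℝ} [Fintype (B.X d)]
    (hγ : ∀ s, ∀ a ∈ f.pos s, ∫ x in B.openTile s a, G x = γ s) {l : ℝ}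
    (hl : Filter.Tendsto (fun r : ℕ => (∫ x in Metric.ball (0 : E) r, G x) /
      volume.real (Metric.ball (0 : E) r)) Filter.atTop (nhds l)) :
    Filter.Tendsto (fun r : ℕ => (∑ s, ((f.patch s r).ncard : ℝ) * γ s) /
      volume.real (Metric.ball (0 : E) r)) Filter.atTop (nhds l) := by
  obtain ⟨D, hD0, hD⟩ := f.ball_ae_le_patchUnion
  have hC0 : 0 ≤ C := (abs_nonneg _).trans (hC 0)
  have hint : ∀ r : ℕ, IntegrableOn G (Metric.ball (0 : E) r) := fun r =>
    Measure.integrableOn_of_bounded (M := C) measure_ball_lt_top.ne hG.aestronglyMeasurable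
      (Filter.Eventually.of_forall hC)
  have main : ∀ r : ℕ, |(∫ x in Metric.ball (0 : E) r, G x) - ∫ x in f.patchUnion r, G x| ≤
      C * volume.real (Metric.ball (0 : E) (r + 0) \ Metric.ball 0 (r + -D)) := by
    intro r
    have hm := (f.isOpen_patchUnion r).measurableSet
    rw [← integral_inter_add_sdiff hm (hint r),
      inter_eq_self_of_subset_right (f.patchUnion_subset r), add_sub_cancel_left]
    have h1 : volume (Metric.ball (0 : E) r \ f.patchUnion r) < ⊤ :=
      (measure_mono sdiff_subset).trans_lt measure_ball_lt_top
    refine (norm_setIntegral_le_of_norm_le_const h1 fun x _ =>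
        (Real.norm_eq_abs _).trans_le (hC x)).trans
      (mul_le_mul_of_nonneg_left ?_ hC0)
    refine ENNReal.toReal_mono ((measure_mono sdiff_subset).trans_lt measure_ball_lt_top).ne
      (measure_mono_ae ?_)
    rw [add_zero, ← sub_eq_add_neg]
    exact Filter.EventuallyLE.diff Filter.EventuallyLE.rfl (hD r)
  have h0 : Filter.Tendsto (fun r : ℕ => ((∫ x in Metric.ball (0 : E) r, G x) -
      ∫ x in f.patchUnion r, G x) / volume.real (Metric.ball (0 : E) r)) Filter.atTop (nhds 0) := by
    have hshell := (tendsto_measureReal_shell_div (volume : Measure E) (-D) 0 (by linarith)).const_mul C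
    rw [mul_zero] at hshell
    refine squeeze_zero_norm (fun r => ?_) hshell
    rw [Real.norm_eq_abs, abs_div, abs_of_nonneg measureReal_nonneg, ← mul_div_assoc]
    exact div_le_div_of_nonneg_right (main r) measureReal_nonneg
  have h := hl.sub h0
  rw [sub_zero] at h
  refine h.congr fun r => ?_
  rw [← f.setIntegral_patchUnion hγ r (hint r)]
  ring

end Averages

end IsometricWinding

end FBSComplex

/-- Turns limits of continuous functionals along `c_r` into exact values at an accumulation point.
-/
theorem eq_of_mapClusterPt_of_tendsto {α X Y : Type*} [TopologicalSpace X] [TopologicalSpace Y]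
    [T2Space Y] {l : Filter α} {u : α → X} {φ : X → Y} {x : X} {y : Y} (hφ : Continuous φ)
    (hx : MapClusterPt x l u) (hy : Filter.Tendsto (fun a => φ (u a)) l (nhds y)) : φ x = y :=
  eq_of_nhds_neBot (ClusterPt.mono (hx.continuousAt_comp hφ.continuousAt) hy)

namespace SemiSimplicialSet

/-! ### Coefficients of chains and of their boundaries. -/

section FiniteChains

variable {S : SemiSimplicialSet.{u}} {R : Type*} [CommRing R]

theorem extend_eq_sum {A : Type*} [AddCommGroup A] [Module R A] {k : ℕ} [Fintype (S.X k)]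
    (φ : S.X k → A) (c : S.Chains R k) : S.extend R φ c = ∑ s, coeff c s • φ s :=
  (Finsupp.linearCombination_apply R c).trans (Finsupp.sum_fintype _ _ fun _ => zero_smul _ _)

variable (S R) in
/-- The coefficient of a simplex as a linear functional. -/
def coeffLinear {k : ℕ} (s : S.X k) : S.Chains R k →ₗ[R] R := Finsupp.lapply s

open Classical in
theorem coeffLinear_single {k : ℕ} (s u : S.X k) (r : R) :
    coeffLinear S R u (single R s r) = if s = u then r else 0 :=
  Finsupp.single_apply

theorem chains_ext {k : ℕ} {c c' : S.Chains R k} (h : ∀ s, coeff c s = coeff c' s) : c = c' :=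
  Finsupp.ext h

open Classical in
/-- The incidence number of a simplex and a codimension one simplex. -/
noncomputable def incidence {k : ℕ} (s : S.X (k + 1)) (u : S.X k) : ℝ :=
  ∑ i : Fin (k + 2), if S.face i s = u then (-1) ^ (i : ℕ) else 0

theorem coeff_boundary {k : ℕ} [Fintype (S.X (k + 1))] (c : S.Chains ℝ (k + 1)) (u : S.X k) :
    coeff (S.boundary ℝ k c) u = ∑ s, coeff c s * incidence s u := by
  change coeffLinear S ℝ u (S.boundary ℝ k c) = _
  rw [boundary, extend_eq_sum]
  simp only [map_sum, map_smul, coeffLinear_single, smul_eq_mul, mul_ite, mul_one, mul_zero,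
    incidence]

end FiniteChains

end SemiSimplicialSet

namespace FBSComplex

open SemiSimplicialSet

section Orientation

variable {d : ℕ} {E : Type*} [NormedAddCommGroup E] [InnerProductSpace ℝ E]
  [hd : Fact (Module.finrank ℝ E = d)] (o : Orientation ℝ E (Fin d))
  (B : FBSComplex.{u} d E)

theorem orientSign_mul_edgeVolume (s : B.X d) :
    B.orientSign o s * B.edgeVolume o s = |B.edgeVolume o s| :=
  sign_mul_self _

variable [FiniteDimensional ℝ E]

theorem orientSign_mul_self (s : B.X d) : B.orientSign o s * B.orientSign o s = 1 := by
  have h := B.edgeVolume_ne_zero o s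
  change (SignType.sign (B.edgeVolume o s) : ℝ) * (SignType.sign (B.edgeVolume o s) : ℝ) = 1
  rcases lt_or_gt_of_ne h with h | h <;> simp [h]

end Orientation

/-! ### Flux through a codimension one face. -/

section Faces

variable {k : ℕ} {E : Type*} [NormedAddCommGroup E] [InnerProductSpace ℝ E]
  [FiniteDimensional ℝ E] [hd : Fact (Module.finrank ℝ E = k + 1)]
  (o : Orientation ℝ E (Fin (k + 1))) (B : FBSComplex.{u} (k + 1) E)

theorem edgeVec_rho_face {d n : ℕ} {E : Type*} [NormedAddCommGroup E] [NormedSpace ℝ E]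
    (B : FBSComplex.{u} d E) (i : Fin (n + 2)) (s : B.X (n + 1)) (j : Fin (n + 1)) :
    edgeVec B.rho (B.S.face i s) j =
      edgeVec B.rho s (i.succAbove j) - edgeVec B.rho s (i.succAbove 0) :=
  edgeVec_map B.rho (fun s i j l hij hjl => by
    rw [← boundary_triangle s i j l hij hjl, B.rho_boundary]) (Fin.succAboveOrderEmb i) s j

/-- The value of the volume form on `n` followed by the edges of `u` originating in its vertex `0`. -/
noncomputable def faceFlux (n : E) (u : B.X k) : ℝ :=
  o.volumeForm (Fin.cons n fun l : Fin k => edgeVec B.rho u l.succ)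

/-- The flux is intrinsic to the face, whereas the right side refers to a simplex `s` and a place
`i` in it. All tiles with a face `u` therefore contribute multiples of one number. -/
theorem faceFlux_face (n : E) (s : B.X (k + 1)) (i : Fin (k + 2)) :
    B.faceFlux o n (B.S.face i s) =
      -((-1) ^ (i : ℕ) * (baryLinear (k + 1) ((B.frame s).symm n) i * B.edgeVolume o s)) := by
  have h := alternating_cons_face o.volumeForm (edgeVec B.rho s) (by simp [edgeVec])
    ((B.frame s).symm n) i
  rw [← frame_apply, ContinuousLinearEquiv.apply_symm_apply] at h
  simp only [faceFlux, edgeVec_rho_face]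
  exact h

/-- The barycentric coordinate opposite to the face is not constant, so it varies along some
direction. -/
theorem exists_faceFlux_ne_zero (s : B.X (k + 1)) (i : Fin (k + 2)) :
    ∃ n, B.faceFlux o n (B.S.face i s) ≠ 0 := by
  have h : ∃ w, baryLinear (k + 1) w i ≠ 0 := by
    refine Fin.cases ⟨Pi.single 0 1, ?_⟩ (fun m => ⟨Pi.single m 1, ?_⟩) i
    · simp [baryLinear_apply_zero]
    · simp [baryLinear_apply_succ]
  obtain ⟨w, hw⟩ := h
  refine ⟨B.frame s w, ?_⟩
  rw [faceFlux_face, ContinuousLinearEquiv.symm_apply_apply]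
  exact neg_ne_zero.2 (mul_ne_zero (pow_ne_zero _ (by norm_num))
    (mul_ne_zero hw (B.edgeVolume_ne_zero o s)))

/-- Each face of `s` equal to `u` contributes its bubble integral. The sign from `faceFlux_face`
becomes the sign in the incidence number, and the absolute value of the volume becomes `orientSign`,
as in the coefficients of `c_r`. -/
theorem setIntegral_fderiv_facePoly (n : E) (u : B.X k) (s : B.X (k + 1)) :
    |B.edgeVolume o s| * ∫ y in solidSimplex (k + 1),
        fderiv ℝ (fun z => facePoly u s (bary z)) y ((B.frame s).symm n) =
      bubbleMass k * B.faceFlux o n u * (B.orientSign o s * incidence s u) := by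
  classical
  have hdiff : ∀ (i : Fin (k + 2)) y,
      DifferentiableAt ℝ (fun z : Fin (k + 1) → ℝ => faceBubble i (bary z)) y := fun i y =>
    ((contDiff_faceBubble i).comp contDiff_bary).differentiable (by simp) y
  have h1 : ∀ y, fderiv ℝ (fun z => facePoly u s (bary z)) y ((B.frame s).symm n) =
      ∑ i, if B.S.face i s = u then
        fderiv ℝ (fun z => faceBubble i (bary z)) y ((B.frame s).symm n) else 0 := by
    intro y
    simp only [facePoly_succ]
    rw [fderiv_fun_sum]
    · rw [_root_.sum_apply]
      refine Finset.sum_congr rfl fun i _ => ?_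
      split_ifs <;> simp
    · intro i _
      split_ifs
      · exact hdiff i y
      · exact differentiableAt_const _
  simp only [h1]
  rw [integral_finsetSum]
  · rw [incidence, Finset.mul_sum, Finset.mul_sum, Finset.mul_sum]
    refine Finset.sum_congr rfl fun i _ => ?_
    split_ifs with h
    · have hf := B.faceFlux_face o n s i
      have hs : ((-1 : ℝ) ^ (i : ℕ)) * (-1) ^ (i : ℕ) = 1 := by rw [← mul_pow]; simp
      rw [setIntegral_fderiv_faceBubble, ← h, hf, ← orientSign_mul_edgeVolume]
      linear_combination (B.orientSign o s * B.edgeVolume o s * bubbleMass k *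
        baryLinear (k + 1) ((B.frame s).symm n) i) * hs
    · simp
  · intro i _
    split_ifs
    · exact (((((contDiff_faceBubble i).comp contDiff_bary).continuous_fderiv (by simp)).clm_apply
        continuous_const).continuousOn).integrableOn_compact (isCompact_solidSimplex _)
    · simp

end Faces

/-! ### Asymptotics of the chains `c_r`. -/

namespace IsometricWinding

section

variable {d : ℕ} {E : Type*} [NormedAddCommGroup E] [InnerProductSpace ℝ E]
  [FiniteDimensional ℝ E] [hd : Fact (Module.finrank ℝ E = d)] [MeasurableSpace E] [BorelSpace E]
  (o : Orientation ℝ E (Fin d)) {B : FBSComplex.{u} d E} (f : B.IsometricWinding)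

/-- The value does not depend on the position `a`, as `tendsto_sum_patch` requires. -/
theorem setIntegral_lineDeriv_openTile {w : B.S.Realization → ℝ}
    {p : B.X d → (Fin (d + 1) → ℝ) → ℝ} (hp : ∀ s, ContDiff ℝ ∞ (p s))
    (hwp : ∀ s t, w (char s t) = p s t) {s : B.X d} {a : E} (ha : a ∈ f.pos s) (n : E) :
    ∫ x in B.openTile s a, lineDeriv ℝ (w ∘ f.toFun) x n =
      |B.edgeVolume o s| * ∫ y in solidSimplex d,
        fderiv ℝ (fun z => p s (bary z)) y ((B.frame s).symm n) := by
  have h1 : ∀ x ∈ B.openTile s a, lineDeriv ℝ (w ∘ f.toFun) x n =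
      fderiv ℝ (localForm B p s) (x - a) n := by
    intro x hx
    have he : w ∘ f.toFun =ᶠ[nhds x] fun x => localForm B p s (x - a) := by
      filter_upwards [(B.isOpen_openTile s a).mem_nhds hx] with y hy
      exact f.comp_eq_localForm_openTile hwp ha hy
    have hdiff : Differentiable ℝ (localForm B p s) :=
      (contDiff_localForm hp s).differentiable (by simp)
    rw [he.lineDeriv_eq, DifferentiableAt.lineDeriv_eq_fderiv, fderiv_comp_sub]
    exact (hdiff _).comp x (by fun_prop)
  rw [setIntegral_congr_fun (B.isOpen_openTile s a).measurableSet h1, B.setIntegral_openTile o]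
  congr 1
  refine integral_congr_ae (Filter.Eventually.of_forall fun y => ?_)
  dsimp only
  have h2 : localForm B p s = (fun z => p s (bary z)) ∘ (B.frame s).symm := rfl
  rw [add_sub_cancel_left, h2, (B.frame s).symm.comp_right_fderiv]
  simp

theorem coeff_normalizedPatch (r : ℝ) (s : B.X d) :
    coeff (f.normalizedPatch o r) s =
      B.orientSign o s * ((f.patch s r).ncard / volume.real (Metric.ball (0 : E) r)) := by
  have : coeff (f.normalizedPatch o r) s = (volume.real (Metric.ball (0 : E) r))⁻¹ *
      (B.orientSign o s * ((f.patch s r).ncard : ℝ)) := rfl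
  rw [this]
  ring

/-- The volume of the patches divided by the volume of the balls tends to `1`. -/
theorem tendsto_sum_volume [Fintype (B.X d)] :
    Filter.Tendsto (fun r : ℕ => (∑ s, ((f.patch s r).ncard : ℝ) *
        (|B.edgeVolume o s| * volume.real (solidSimplex d))) /
      volume.real (Metric.ball (0 : E) r)) Filter.atTop (nhds 1) := by
  refine f.tendsto_sum_patch (G := fun _ => 1) (C := 1) measurable_const (by simp) (fun s a _ => ?_) ?_
  · rw [setIntegral_const, smul_eq_mul, mul_one, B.volume_openTile o]
  · refine tendsto_const_nhds.congr' ?_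
    filter_upwards [Filter.eventually_gt_atTop 0] with r hr
    rw [setIntegral_const, smul_eq_mul, mul_one, div_self]
    exact (measureReal_ball_pos volume (by positivity)).ne'

theorem tendsto_coeff_volume [Fintype (B.X d)] :
    Filter.Tendsto (fun r : ℕ => ∑ s, coeff (f.normalizedPatch o r) s *
      (B.edgeVolume o s * volume.real (solidSimplex d))) Filter.atTop (nhds 1) := by
  refine (f.tendsto_sum_volume o).congr fun r => ?_
  rw [Finset.sum_div]
  refine Finset.sum_congr rfl fun s _ => ?_
  rw [coeff_normalizedPatch, ← orientSign_mul_edgeVolume]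
  ring

theorem exists_mapClusterPt : ∃ x : B.X d → ℝ, MapClusterPt x Filter.atTop
    (fun r : ℕ => coeff (f.normalizedPatch o r)) := by
  have := B.finite d
  have := Fintype.ofFinite (B.X d)
  let γ : B.X d → ℝ := fun s => |B.edgeVolume o s| * volume.real (solidSimplex d)
  have hγ : ∀ s, 0 < γ s := fun s =>
    mul_pos (abs_pos.2 (B.edgeVolume_ne_zero o s)) (volume_solidSimplex_pos d)
  have hc : IsCompact (univ.pi fun s : B.X d => Icc (-(2 / γ s)) (2 / γ s)) :=
    isCompact_univ_pi fun s => isCompact_Icc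
  obtain ⟨x, -, hx⟩ := hc.exists_mapClusterPt (f := Filter.atTop)
    (u := fun r : ℕ => coeff (f.normalizedPatch o r)) (by
      rw [Filter.le_principal_iff, Filter.mem_map]
      -- The total volume ratio tends to `1`, hence is eventually at most `2`; its terms are
      -- non-negative, so each obeys the same bound.
      filter_upwards [(f.tendsto_sum_volume o).eventually_le_const one_lt_two] with r hr s _
      rw [Finset.sum_div] at hr
      have h1 : ((f.patch s r).ncard : ℝ) * γ s / volume.real (Metric.ball (0 : E) r) ≤ 2 :=
        (Finset.single_le_sum (f := fun s => ((f.patch s r).ncard : ℝ) * γ s /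
          volume.real (Metric.ball (0 : E) r)) (fun s _ => by
            have := (hγ s).le
            positivity) (Finset.mem_univ s)).trans hr
      have h2 : ((f.patch s r).ncard : ℝ) / volume.real (Metric.ball (0 : E) r) ≤ 2 / γ s := by
        rw [le_div_iff₀ (hγ s)]
        exact (le_of_eq (by ring)).trans h1
      have h3 : |B.orientSign o s| = 1 := by
        have h := B.orientSign_mul_self o s
        rw [← abs_mul_abs_self] at h
        nlinarith [abs_nonneg (B.orientSign o s)]
      change coeff (f.normalizedPatch o r) s ∈ Icc (-(2 / γ s)) (2 / γ s)
      rw [mem_Icc, ← abs_le, coeff_normalizedPatch, abs_mul, h3, one_mul, abs_of_nonneg (by positivity)]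
      exact h2)
  exact ⟨x, hx⟩

end

/-- These sums are the coefficients of `∂c_r` at `u`. Up to the factor `bubbleMass k * faceFlux`,
they are the sums over patches attached to the derivative of the pulled-back weight of `u`, whose
averages tend to `0`. -/
theorem tendsto_coeff_boundary {k : ℕ} {E : Type*} [NormedAddCommGroup E] [InnerProductSpace ℝ E]
    [FiniteDimensional ℝ E] [hd : Fact (Module.finrank ℝ E = k + 1)] [MeasurableSpace E]
    [BorelSpace E] (o : Orientation ℝ E (Fin (k + 1))) {B : FBSComplex.{u} (k + 1) E}
    (f : B.IsometricWinding) [Fintype (B.X (k + 1))] (u : B.X k) :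
    Filter.Tendsto (fun r : ℕ => ∑ s, coeff (f.normalizedPatch o r) s * incidence s u)
      Filter.atTop (nhds 0) := by
  classical
  by_cases hu : ∃ (s : B.X (k + 1)) (i : Fin (k + 2)), B.S.face i s = u
  · have hn : ∃ n, B.faceFlux o n u ≠ 0 := by
      obtain ⟨s, i, rfl⟩ := hu
      exact B.exists_faceFlux_ne_zero o s i
    obtain ⟨n, hn⟩ := hn
    obtain ⟨⟨K, hK⟩, C, hC⟩ := f.exists_lipschitz_bounded (continuous_faceWeight u)
      (p := fun s => facePoly u s) (contDiff_facePoly u) (faceWeight_char u)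
    have h := f.tendsto_sum_patch (measurable_lineDeriv hK.continuous)
      (fun x => norm_lineDeriv_le_of_lipschitz ℝ hK)
      (fun s a ha => (f.setIntegral_lineDeriv_openTile o (contDiff_facePoly u) (faceWeight_char u)
        ha n).trans (B.setIntegral_fderiv_facePoly o n u s))
      (tendsto_average_lineDeriv volume hK hC n)
    have h' := h.const_mul (bubbleMass k * B.faceFlux o n u)⁻¹
    rw [mul_zero] at h'
    refine h'.congr fun r => ?_
    have hm := (bubbleMass_pos k).ne'
    rw [Finset.sum_div, Finset.mul_sum]
    refine Finset.sum_congr rfl fun s _ => ?_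
    rw [coeff_normalizedPatch]
    field_simp
  -- If `u` is not a face of any top simplex, no transverse direction is needed: all incidence
  -- numbers vanish.
  · have h0 : ∀ s : B.X (k + 1), incidence s u = 0 := fun s =>
      Finset.sum_eq_zero fun i _ => if_neg fun h => hu ⟨s, i, h⟩
    simp [h0]

end IsometricWinding

/-! ### The class `ω_E` as signed volume. -/

section Pairing

variable {d : ℕ} {E : Type*} [NormedAddCommGroup E] [InnerProductSpace ℝ E]
  [hd : Fact (Module.finrank ℝ E = d)]
  (o : Orientation ℝ E (Fin d)) {B : FBSComplex.{u} d E}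
  {V : Type*} [NormedAddCommGroup V] [NormedSpace ℝ V] [FiniteDimensional ℝ V]
  {Λ : Submodule ℤ V} [DiscreteTopology Λ] (D : B.Lifting Λ)

/-- On `s` the map `β` lifts to an affine map with edges `rhoLift e`, and `piE` turns these into
`rho e`. The integrand is therefore the constant `edgeVolume`. -/
theorem formIntegral_betaHom (s : B.X d) :
    formIntegral ((volForm o).compContinuousLinearMap (LinearMap.toContinuousLinearMap D.piE))
      (D.betaHom.app d s) = B.edgeVolume o s * volume.real (solidSimplex d) := by
  let L : (Fin (d + 1) → ℝ) →L[ℝ] V :=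
    ∑ j, (ContinuousLinearMap.proj (R := ℝ) (φ := fun _ : Fin (d + 1) => ℝ) j).smulRight
      (edgeVec D.rhoLift s j)
  have hL : ∀ t, L t = ∑ j, t j • edgeVec D.rhoLift s j := fun t => by
    simp [L]
  refine (formIntegral_eq (Λ := Λ) _ _ (fun t => D.vertexLift (vertex s 0) + L t)
    (contDiff_const.add L.contDiff) fun t => ?_).trans ?_
  swap
  · have h1 : ∀ (x : Fin d → ℝ) (i : Fin d),
        D.piE (fderiv ℝ (fun y => D.vertexLift (vertex s 0) + L (bary y)) x (Pi.single i 1)) =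
          edgeVec B.rho s i.succ := by
      intro x i
      have hc : HasFDerivAt (fun y => D.vertexLift (vertex s 0) + L (bary y))
          (L.comp (LinearMap.toContinuousLinearMap (baryLinear d))) x :=
        (L.hasFDerivAt.comp x (hasFDerivAt_bary x)).const_add _
      rw [hc.fderiv, ContinuousLinearMap.comp_apply, LinearMap.coe_toContinuousLinearMap',
        baryLinear_single, map_sub, hL, hL, Finset.sum_eq_single i.succ, Finset.sum_eq_single 0]
      · simp [edgeVec, D.piE_rhoLift]
      all_goals simp +contextual
    simp only [liftIntegral, ContinuousAlternatingMap.compContinuousLinearMap_apply,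
      Function.comp_def, LinearMap.coe_toContinuousLinearMap', h1]
    rw [setIntegral_const, smul_eq_mul, mul_comm]
    rfl
  · change D.beta (char s t) = _
    rw [D.beta_char, Lifting.vertexImage, ← map_add, hL]

theorem omegaE_betaStar [Fintype (B.X d)] (z : B.S.cycles ℝ d) :
    D.omegaE o (D.betaStar d (homologyClass z)) =
      ∑ s, coeff z.1 s * (B.edgeVolume o s * volume.real (solidSimplex d)) := by
  change formOnChains Λ _ (D.betaHom.chainMap ℝ d z) = _
  rw [Hom.chainMap, extend_eq_sum, map_sum]
  refine Finset.sum_congr rfl fun s _ => ?_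
  rw [map_smul, formOnChains, extend_single, one_smul, formIntegral_betaHom, smul_eq_mul]

end Pairing

theorem mem_cycles_of_mapClusterPt {d : ℕ} {E : Type*} [NormedAddCommGroup E]
    [InnerProductSpace ℝ E] [FiniteDimensional ℝ E] [hd : Fact (Module.finrank ℝ E = d)]
    [MeasurableSpace E] [BorelSpace E] (o : Orientation ℝ E (Fin d)) {B : FBSComplex.{u} d E}
    (f : B.IsometricWinding) (z : B.S.Chains ℝ d)
    (hz : MapClusterPt (coeff z) Filter.atTop (fun r : ℕ => coeff (f.normalizedPatch o r))) :
    z ∈ B.S.cycles ℝ d := by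
  cases d with
  -- In dimension zero every chain is a cycle.
  | zero => exact Submodule.mem_top
  | succ k =>
    have := B.finite (k + 1)
    have := Fintype.ofFinite (B.X (k + 1))
    change B.S.boundary ℝ k z = 0
    refine chains_ext fun u => ?_
    rw [coeff_boundary]
    have h : Continuous fun x : B.X (k + 1) → ℝ => ∑ s, x s * incidence s u := by fun_prop
    have h0 := eq_of_mapClusterPt_of_tendsto h hz (f.tendsto_coeff_boundary o u)
    exact h0

end FBSComplex

end FBS

theorem mainTheorem5 {d : ℕ} {E : Type*} [NormedAddCommGroup E] [InnerProductSpace ℝ E]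
    [FiniteDimensional ℝ E] [Fact (Module.finrank ℝ E = d)] [MeasurableSpace E] [BorelSpace E]
    (o : Orientation ℝ E (Fin d)) (B : FBS.FBSComplex d E)
    {V : Type*} [NormedAddCommGroup V] [NormedSpace ℝ V] [FiniteDimensional ℝ V]
    (Λ : Submodule ℤ V) [DiscreteTopology Λ] [IsZLattice ℝ Λ] (D : B.Lifting Λ)
    (f : B.IsometricWinding) :
    ∃ c : B.S.Homology ℝ d, D.omegaE o (D.betaStar d c) = 1 ∧
      ∃ z ∈ B.positiveCycles o, FBS.SemiSimplicialSet.homologyClass z = c ∧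
        MapClusterPt (FBS.SemiSimplicialSet.coeff z.1) Filter.atTop
          (fun r : ℕ => FBS.SemiSimplicialSet.coeff (f.normalizedPatch o r)) := by
  have := B.finite d
  have := Fintype.ofFinite (B.X d)
  obtain ⟨x, hx⟩ := f.exists_mapClusterPt o
  let z : B.S.Chains ℝ d := (Finsupp.equivFunOnFinite.symm x : B.X d →₀ ℝ)
  have hzx : FBS.SemiSimplicialSet.coeff z = x := rfl
  have hz := FBS.FBSComplex.mem_cycles_of_mapClusterPt o f z (hzx ▸ hx)
  refine ⟨_, ?_, ⟨z, hz⟩, fun s => ?_, rfl, hx⟩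
  · rw [FBS.FBSComplex.omegaE_betaStar, hzx]
    have h : Continuous fun x : B.X d → ℝ => ∑ s, x s *
        (B.edgeVolume o s * MeasureTheory.volume.real (FBS.solidSimplex d)) := by fun_prop
    have h1 := FBS.eq_of_mapClusterPt_of_tendsto h hx (f.tendsto_coeff_volume o)
    exact h1
  -- Non-negativity is a closed condition, and it holds for each `c_r`: the square of the sign is
  -- `1`, which leaves a count divided by a volume.
  · have h : Continuous fun x : B.X d → ℝ => B.orientSign o s * x s := by fun_prop
    refine isClosed_Ici.mem_of_mapClusterPt (hx.continuousAt_comp (h.continuousAt (x := x)))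
      (Filter.Eventually.of_forall fun r => ?_)
    simp only [Function.comp_apply, Set.mem_Ici, FBS.FBSComplex.IsometricWinding.coeff_normalizedPatch,
      ← mul_assoc, FBS.FBSComplex.orientSign_mul_self, one_mul]
    positivity
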